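/- Let $1<Q<2$, let $t\in(0,1)$ satisfy $\ln 2/\ln(1/t)=Q-1$ (so $t<\tfrac12$), let $j\in\mathbb N$ satisfy $\frac1{j+1}<t\le\frac1j$, and let $j_1,j_2,\ldots\in\{j,j+1\}$ satisfy $\frac{j}{j+1}\prod_{i=1}^m j_i^{-1}\le t^m\le\frac{j+1}{j}\prod_{i=1}^m j_i^{-1}$ for all $m$. Let $K$ be the Cantor set with $K=tK\cup(tK+1-t)$; put $\psi_0(x)=tx$, $\psi_1(x)=tx+1-t$, and for a finite address $a=a_1\cdots a_n\in\{0,1\}^n$ call $K_a=\psi_{a_1}\circ\cdots\circ\psi_{a_n}(K)$ a cell of depth $n$. Let $I=[0,1]$. The locations of the wormholes of level $l\ge1$ are the numbers $$w(m_1,\ldots,m_l)=\sum_{i=1}^l m_i\prod_{h=1}^i j_h^{-1},\qquad 0\le m_i<j_i\ (i<l),\quad 0<m_l<j_l .$$ Let $L$ be the quotient of $I\times K$ obtained by identifying, for all $l\ge1$, all addresses $a$ of length $l-1$ and all locations $x$ of wormholes of level $l$, the points $(x,u)$ with $u\in K_{a0}$ and $(x,u+t^{l-1}(1-t))$. Let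 $\iota:I\times K\to L$ be the identification map and let $\mu$ be the image under $\iota$ of the product of the Lebesgue measure on $I$ and the Bernoulli measure on $K$ (for which $K_a$ has measure $2^{-n}$ if $a$ has length $n$). Equip $L$ with the geodesic distance: the infimum of the lengths of the paths joining two points, where the length of a path is the total distance (total variation) it travels in the $I$-coordinate. For $n\ge0$ let $\mathcal G_n$ be the set of all continuous $f:L\to\mathbb R$ such that, with $\hat f=f\circ\iota$: for each $x\in I$ the function $\hat f(x,\cdot)$ is constant on each cell of depth $n$ of $K$; and for each $w\in K$ the function $\hat f(\cdot,w)$ is continuously differentiable on the complement in $I$ of the wormhole locations of levels $1,\ldots,n$ (one-sidedly at the end points $0$ and $1$ of $I$), and its derivative has finite one-sided limits at these locations. A generalized upper gradient of $u:L\to\mathbb R$ is a Borel function $g:L\to[0,\infty]$ such that $|u(\gamma(0))-u(\gamma(1))|\le\int_\gamma g\,dm$ for every rectifiable curve $\gamma:[0,1]\to L$, where $dm$ is arc length along $\gamma$. For $1<r<\infty$, a minimal generalized upper gradient $p_u$ of $u$ is a generalized upper gradient in $L^r(L,\mu)$ such that $p_u\le g$ $\mu$-almost everywhere for every generalized upper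 gradient $g$ of $u$ in $L^r(L,\mu)$. **Theorem.** Let $n\ge0$, $f\in\mathcal G_n$ and $1<r<\infty$. Then $f$ has a minimal generalized upper gradient, and for every minimal generalized upper gradient $p_f$ of $f$ one has, for $\mu$-almost every $q\in L$: for every $(x,w)\in I\times K$ with $\iota(x,w)=q$ such that $x$ is not the location of a wormhole of level at most $n$, the derivative $\frac{\partial\hat f}{\partial x}(x,w)$ exists (one-sidedly if $x\in\{0,1\}$) and $$p_f(q)=\left|\frac{\partial\hat f}{\partial x}(x,w)\right| .$$ -/

import Mathlib

open Set Filter Topology MeasureTheory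
open scoped ENNReal

noncomputable section

/-! ### The Cantor set with contraction factor `t` -/

/-- The two contractions `x ↦ t x` (for `false`, the letter `0`) and `x ↦ t x + (1 - t)`
(for `true`, the letter `1`). -/
def cantorMap (t : ℝ) (b : Bool) (x : ℝ) : ℝ := t * x + if b then 1 - t else 0

/-- The point of the Cantor set with the infinite address `a`. -/
def cantorPoint (t : ℝ) (a : ℕ → Bool) : ℝ := ∑' i, if a i then (1 - t) * t ^ i else 0

/-- The Cantor set with contraction factor `t`: the set of all points with an infinite address.
For `0 < t < 1` it is the nonempty compact set with `K = t K ∪ (t K + 1 - t)`, see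
`cantorK_nonempty`, `isCompact_cantorK` and `cantorK_eq_union`. -/
def cantorK (t : ℝ) : Set ℝ := range (cantorPoint t)

/-- The cell `K_a` of the Cantor set with the finite address `a`; it is a cell of depth
`a.length`. -/
def cantorCell (t : ℝ) : List Bool → Set ℝ
  | [] => cantorK t
  | b :: a => cantorMap t b '' cantorCell t a

theorem cantorK_nonempty (t : ℝ) : (cantorK t).Nonempty := range_nonempty _

theorem norm_cantorTerm_le {t : ℝ} (h0 : 0 < t) (h1 : t < 1) (a : ℕ → Bool) (i : ℕ) :
    ‖(if a i then (1 - t) * t ^ i else 0 : ℝ)‖ ≤ (1 - t) * t ^ i := by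
  have h : 0 ≤ (1 - t) * t ^ i := mul_nonneg (by linarith) (by positivity)
  split_ifs
  · rw [Real.norm_of_nonneg h]
  · simpa using h

theorem summable_cantorBound {t : ℝ} (h0 : 0 < t) (h1 : t < 1) :
    Summable fun i : ℕ => (1 - t) * t ^ i :=
  (summable_geometric_of_lt_one h0.le h1).mul_left _

theorem continuous_cantorPoint {t : ℝ} (h0 : 0 < t) (h1 : t < 1) :
    Continuous (cantorPoint t) := by
  refine continuous_tsum (fun i => ?_) (summable_cantorBound h0 h1)
    (fun i a => norm_cantorTerm_le h0 h1 a i)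
  exact (continuous_of_discreteTopology (f := fun b : Bool =>
    (if b then (1 - t) * t ^ i else 0 : ℝ))).comp (continuous_apply i)

theorem isCompact_cantorK {t : ℝ} (h0 : 0 < t) (h1 : t < 1) : IsCompact (cantorK t) :=
  isCompact_range (continuous_cantorPoint h0 h1)

theorem cantorPoint_eq {t : ℝ} (h0 : 0 < t) (h1 : t < 1) (a : ℕ → Bool) :
    cantorPoint t a = cantorMap t (a 0) (cantorPoint t fun i => a (i + 1)) := by
  have hs : Summable fun i => (if a i then (1 - t) * t ^ i else 0 : ℝ) :=
    Summable.of_norm_bounded (summable_cantorBound h0 h1) (norm_cantorTerm_le h0 h1 a)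
  unfold cantorPoint cantorMap
  rw [hs.tsum_eq_zero_add, ← tsum_mul_left, add_comm]
  congr 1
  · refine tsum_congr fun i => ?_
    split_ifs <;> ring
  · simp

theorem cantorK_eq_union {t : ℝ} (h0 : 0 < t) (h1 : t < 1) :
    cantorK t = cantorMap t false '' cantorK t ∪ cantorMap t true '' cantorK t := by
  ext x
  constructor
  · rintro ⟨a, rfl⟩
    rw [cantorPoint_eq h0 h1]
    cases a 0
    · exact Or.inl ⟨_, ⟨_, rfl⟩, rfl⟩
    · exact Or.inr ⟨_, ⟨_, rfl⟩, rfl⟩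
  · have key : ∀ b a, cantorMap t b (cantorPoint t a) ∈ cantorK t := fun b a =>
      ⟨fun i => Nat.casesOn i b a, cantorPoint_eq h0 h1 _⟩
    rintro (⟨_, ⟨a, rfl⟩, rfl⟩ | ⟨_, ⟨a, rfl⟩, rfl⟩)
    · exact key _ _
    · exact key _ _

/-- The Bernoulli measure on the Cantor set: the law of the point whose address letters are
independent fair coin tosses, so that a cell of depth `n` has measure `2 ^ (-n)`. -/
def cantorMeasure (t : ℝ) : Measure (cantorK t) :=
  (Measure.infinitePi fun _ : ℕ => (PMF.uniformOfFintype Bool).toMeasure).map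
    (rangeFactorization (cantorPoint t))

/-! ### The Laakso space -/

/-- The data of a Laakso space of dimension `1 < Q < 2` built with one Cantor set: the contraction
factor `t` of the Cantor set of dimension `Q - 1`, the integer `j` with `1 / (j + 1) < t ≤ 1 / j`
and a sequence `j₁, j₂, …` in `{j, j + 1}` with
`j / (j + 1) * ∏ jᵢ⁻¹ ≤ t ^ m ≤ (j + 1) / j * ∏ jᵢ⁻¹`. (The value `js 0` is never used.) -/
structure IsLaaksoData (Q t : ℝ) (j : ℕ) (js : ℕ → ℕ) : Prop where
  one_lt_dim : 1 < Q
  dim_lt_two : Q < 2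
  ratio_mem : t ∈ Ioo (0 : ℝ) 1
  dim_eq : Real.log 2 / Real.log (1 / t) = Q - 1
  lt_ratio : 1 / ((j : ℝ) + 1) < t
  ratio_le : t ≤ 1 / (j : ℝ)
  seq_mem : ∀ i, 1 ≤ i → js i = j ∨ js i = j + 1
  le_pow : ∀ m, (j : ℝ) / (j + 1) * ∏ i ∈ Finset.Icc 1 m, (js i : ℝ)⁻¹ ≤ t ^ m
  pow_le : ∀ m, t ^ m ≤ ((j : ℝ) + 1) / j * ∏ i ∈ Finset.Icc 1 m, (js i : ℝ)⁻¹

/-- The locations in `I` of the wormholes of level `l ≥ 1`: the numbers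
`w(m₁, …, m_l) = ∑ i ≤ l, mᵢ ∏ h ≤ i, j_h⁻¹` with `0 ≤ mᵢ < jᵢ` for `i < l` and
`0 < m_l < j_l`. -/
def wormholeLoc (js : ℕ → ℕ) (l : ℕ) : Set ℝ :=
  {x | ∃ m : ℕ → ℕ, (∀ i ∈ Finset.Icc 1 l, m i < js i) ∧ 0 < m l ∧
    x = ∑ i ∈ Finset.Icc 1 l, (m i : ℝ) * ∏ h ∈ Finset.Icc 1 i, (js h : ℝ)⁻¹}

/-- The locations of the wormholes of level (depth) at most `n`. -/
def wormholeLocUpTo (js : ℕ → ℕ) (n : ℕ) : Set ℝ :=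
  ⋃ l ∈ Finset.Icc 1 n, wormholeLoc js l

/-- The identifications: for an address `a` of length `l - 1` and a location `x` of a wormhole of
level `l`, the point `(x, u)` with `u ∈ K_{a0}` is identified with `(x, v)`, where
`v = u + t ^ (l - 1) * (1 - t) ∈ K_{a1}`. -/
def wormholeRel (t : ℝ) (js : ℕ → ℕ) (z z' : unitInterval × cantorK t) : Prop :=
  ∃ a : List Bool, (z.1 : ℝ) ∈ wormholeLoc js (a.length + 1) ∧ z'.1 = z.1 ∧
    (z.2 : ℝ) ∈ cantorCell t (a ++ [false]) ∧ (z'.2 : ℝ) = z.2 + t ^ a.length * (1 - t)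

/-- The quotient of `I × K` by the equivalence relation generated by the identifications, with
its quotient topology. It is only used to say what a path in the Laakso space is. -/
abbrev LaaksoQuot (t : ℝ) (js : ℕ → ℕ) : Type := Quot (wormholeRel t js)

/-- The `I`-coordinate on the quotient. -/
def height (t : ℝ) (js : ℕ → ℕ) : LaaksoQuot t js → ℝ :=
  Quot.lift (fun z => (z.1 : ℝ)) fun z z' ⟨_, _, h, _⟩ => by rw [h]

/-- The length of a path in the quotient: the total distance it travels in the `I`-direction
(`∞` if the path is not rectifiable). -/
def pathLength {t : ℝ} {js : ℕ → ℕ} {p q : LaaksoQuot t js} (γ : Path p q) : ℝ≥0∞ :=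
  eVariationOn (fun s : ℝ => height t js (γ.extend s)) (Icc 0 1)

/-- The geodesic distance: the infimum of the lengths of all paths from `p` to `q`. -/
def geodesicDist {t : ℝ} {js : ℕ → ℕ} (p q : LaaksoQuot t js) : ℝ≥0∞ :=
  ⨅ γ : Path p q, pathLength γ

theorem geodesicDist_self {t : ℝ} {js : ℕ → ℕ} (p : LaaksoQuot t js) : geodesicDist p p = 0 := by
  refine le_antisymm (iInf_le_of_le (Path.refl p) (le_of_eq ?_)) bot_le
  refine eVariationOn.constant_on ?_
  rintro _ ⟨x, -, rfl⟩ _ ⟨y, -, rfl⟩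
  simp

theorem pathLength_symm_le {t : ℝ} {js : ℕ → ℕ} {p q : LaaksoQuot t js} (γ : Path p q) :
    pathLength γ.symm ≤ pathLength γ := by
  have := eVariationOn.comp_le_of_antitoneOn (fun s : ℝ => height t js (γ.extend s))
    (s := Icc 0 1) (t := Icc 0 1) (fun s : ℝ => 1 - s) (fun x _ y _ h => sub_le_sub_left h 1)
    (fun x hx => ⟨by linarith [hx.2], by linarith [hx.1]⟩)
  refine le_trans (le_of_eq ?_) this
  refine eVariationOn.congr fun x _ => ?_
  simp [Path.extend_symm_apply]

theorem geodesicDist_comm {t : ℝ} {js : ℕ → ℕ} (p q : LaaksoQuot t js) :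
    geodesicDist p q = geodesicDist q p :=
  le_antisymm (le_iInf fun γ => iInf_le_of_le γ.symm (pathLength_symm_le γ))
    (le_iInf fun γ => iInf_le_of_le γ.symm (pathLength_symm_le γ))

theorem pathLength_trans_le {t : ℝ} {js : ℕ → ℕ} {p q r : LaaksoQuot t js} (γ : Path p q)
    (δ : Path q r) : pathLength (γ.trans δ) ≤ pathLength γ + pathLength δ := by
  have h1 := eVariationOn.comp_le_of_monotoneOn (fun s : ℝ => height t js (γ.extend s))
    (s := Icc 0 1) (t := Icc 0 (1 / 2)) (fun s : ℝ => 2 * s)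
    (fun x _ y _ h => by simpa using h)
    (fun x hx => ⟨by linarith [hx.1], by linarith [hx.2]⟩)
  have h2 := eVariationOn.comp_le_of_monotoneOn (fun s : ℝ => height t js (δ.extend s))
    (s := Icc 0 1) (t := Icc (1 / 2) 1) (fun s : ℝ => 2 * s - 1)
    (fun x _ y _ h => by simpa using h)
    (fun x hx => ⟨by linarith [hx.1], by linarith [hx.2]⟩)
  refine le_trans (le_of_eq ?_) (add_le_add h1 h2)
  have hu := eVariationOn.union (fun s : ℝ => height t js ((γ.trans δ).extend s))
    (s := Icc 0 (1 / 2)) (t := Icc (1 / 2) 1) (x := 1 / 2)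
    (isGreatest_Icc (by norm_num)) (isLeast_Icc (by norm_num))
  rw [Icc_union_Icc_eq_Icc (by norm_num) (by norm_num)] at hu
  rw [pathLength, hu]
  congr 1
  · exact eVariationOn.congr fun x hx => by
      simp [Path.extend_trans_of_le_half γ δ hx.2]
  · exact eVariationOn.congr fun x hx => by
      simp [Path.extend_trans_of_half_le γ δ hx.1]

theorem geodesicDist_triangle {t : ℝ} {js : ℕ → ℕ} (p q r : LaaksoQuot t js) :
    geodesicDist p r ≤ geodesicDist p q + geodesicDist q r :=
  ENNReal.le_iInf_add_iInf fun γ δ => iInf_le_of_le (γ.trans δ) (pathLength_trans_le γ δ)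

/-- The Laakso space `L`, with the geodesic distance. -/
def Laakso (t : ℝ) (js : ℕ → ℕ) : Type := LaaksoQuot t js

/-- The identification map `ι : I × K → L`. -/
def laaksoMap (t : ℝ) (js : ℕ → ℕ) (z : unitInterval × cantorK t) : Laakso t js :=
  Quot.mk (wormholeRel t js) z

/-- The topology of `L` is that of the geodesic distance. For the data of a Laakso space this distance
is finite, it vanishes only for equal points, and its topology is the quotient topology. -/
instance instPseudoEMetricSpaceLaakso (t : ℝ) (js : ℕ → ℕ) :
    PseudoEMetricSpace (Laakso t js) where
  edist p q := geodesicDist (t := t) (js := js) p q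
  edist_self := geodesicDist_self (t := t) (js := js)
  edist_comm := geodesicDist_comm (t := t) (js := js)
  edist_triangle := geodesicDist_triangle (t := t) (js := js)

/-- A set in `L` is measurable if its preimage under `ι` is a Borel subset of `I × K`. For the data
of a Laakso space these are exactly the Borel sets of `L`, because then `ι` is a continuous
surjection from a compact metric space onto a metric space. -/
instance instMeasurableSpaceLaakso (t : ℝ) (js : ℕ → ℕ) : MeasurableSpace (Laakso t js) :=
  MeasurableSpace.map (laaksoMap t js) inferInstance

/-- The measure `μ` on `L`: the image under `ι` of the product of the Lebesgue measure on `I` and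
the Bernoulli measure on `K`. -/
def laaksoMeasure (t : ℝ) (js : ℕ → ℕ) : Measure (Laakso t js) :=
  ((volume : Measure unitInterval).prod (cantorMeasure t)).map (laaksoMap t js)

/-- The pulled back function `f̂ (x, w) = f (ι (x, w))` for a fixed `w`, as a function of a real
variable `x`; it is extended outside of `I = [0, 1]` by its values at the end points. -/
def pullback {t : ℝ} {js : ℕ → ℕ} (f : Laakso t js → ℝ) (w : cantorK t) (x : ℝ) : ℝ :=
  f (laaksoMap t js (projIcc 0 1 zero_le_one x, w))

/-- The class `𝒢_n` of continuous functions `f` on `L` such that `f̂ (x, ·)` is constant on each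
cell of depth `n` of `K`, and `f̂ (·, w)` is continuously differentiable on the complement in
`I` of the wormhole locations of depth `n` or less, where the derivative has finite
one-sided limits. -/
def classG (t : ℝ) (js : ℕ → ℕ) (n : ℕ) : Set C(Laakso t js, ℝ) :=
  {f | (∀ x ∈ Icc (0 : ℝ) 1, ∀ a : List Bool, a.length = n → ∀ w w' : cantorK t,
      (w : ℝ) ∈ cantorCell t a → (w' : ℝ) ∈ cantorCell t a → pullback f w x = pullback f w' x) ∧
    ∀ w : cantorK t, ContDiffOn ℝ 1 (pullback f w) (Icc 0 1 \ wormholeLocUpTo js n) ∧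
      ∀ y ∈ wormholeLocUpTo js n,
        (∃ c : ℝ, Tendsto (deriv (pullback f w)) (𝓝[<] y) (𝓝 c)) ∧
        ∃ c : ℝ, Tendsto (deriv (pullback f w)) (𝓝[>] y) (𝓝 c)}

/-! ### Minimal generalized upper gradients -/

/-- A rectifiable curve `γ : [0, 1] → X`: continuous and of finite length. -/
def IsRectifiable {X : Type*} [PseudoEMetricSpace X] (γ : ℝ → X) : Prop :=
  ContinuousOn γ (Icc 0 1) ∧ eVariationOn γ (Icc 0 1) ≠ ∞

/-- The integral `∫_γ g dm` of a nonnegative function along a rectifiable curve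
`γ : [0, 1] → X` with respect to arc length: the integral over `[0, length γ]` of `g` composed
with the arc length parameterization of `γ`. -/
def arcIntegral {X : Type*} [PseudoEMetricSpace X] (g : X → ℝ≥0∞) (γ : ℝ → X) : ℝ≥0∞ :=
  ∫⁻ s in Icc 0 (eVariationOn γ (Icc 0 1)).toReal, g (naturalParameterization γ (Icc 0 1) 0 s)

/-- A generalized upper gradient of `u`: a (Borel) measurable function `g ≥ 0`, possibly with
infinite values, such that `|u (γ 0) - u (γ 1)| ≤ ∫_γ g dm` for every rectifiable curve `γ`. -/
def IsGeneralizedUpperGradient {X : Type*} [PseudoEMetricSpace X] [MeasurableSpace X]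
    (u : X → ℝ) (g : X → ℝ≥0∞) : Prop :=
  Measurable g ∧ ∀ γ : ℝ → X, IsRectifiable γ →
    ENNReal.ofReal |u (γ 0) - u (γ 1)| ≤ arcIntegral g γ

/-- A minimal generalized upper gradient of `u` in `L^r(μ)`: a generalized upper gradient in
`L^r(μ)` which is almost everywhere at most any other one in `L^r(μ)`. -/
def IsMinimalGeneralizedUpperGradient {X : Type*} [PseudoEMetricSpace X] [MeasurableSpace X]
    (μ : Measure X) (r : ℝ) (u : X → ℝ) (g : X → ℝ≥0∞) : Prop :=
  IsGeneralizedUpperGradient u g ∧ ∫⁻ q, g q ^ r ∂μ < ∞ ∧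
    ∀ g' : X → ℝ≥0∞, IsGeneralizedUpperGradient u g' → ∫⁻ q, g' q ^ r ∂μ < ∞ → g ≤ᵐ[μ] g'

end

noncomputable section

/-! The candidate is `|∂f̂/∂x|`, set to `0` at wormhole heights of level at most `n`. It descends to
a function `horizontalSlope` on `L`: gluings of higher level leave the first `n` letters of an
address unchanged, and `f̂ (·, w)` depends on these letters only. It is bounded, so it lies in
`L^r`.

It lies below every upper gradient `g` in `L^r` (`horizontalSlope_ae_le`). The segments `x ↦ ι (x,
w)` are isometric copies of `I`, so the increments of `f̂ (·, w)` are bounded by integrals of `g`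
along them. By Fubini `g` is integrable on almost every segment, and Lebesgue differentiation gives
`|∂f̂/∂x| ≤ g` almost everywhere.

It is an upper gradient (`isGeneralizedUpperGradient_horizontalSlope`). An arc length
parameterization `c` is 1-Lipschitz, and away from wormhole heights of level at most `n` it stays
locally in one cell of depth `n` (`eventually_mem_cell`). So `f ∘ c` has pointwise Lipschitz
constant at most the slope there. At the exceptional heights, which `c` may visit in a complicated
set of times, `f` takes only finitely many values. Composing `f` with a contraction `φ` that is
close to the identity and locally constant near these values makes the bound hold at every time.
Then `φ ∘ f ∘ c` is Lipschitz, the fundamental theorem of calculus applies, and `φ` is let tend to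
the identity.

Two minimal upper gradients bound each other almost everywhere, so all of them equal the slope. -/

/-! ### Addresses of points of the Cantor set -/

theorem summable_cantorTerm {t : ℝ} (h0 : 0 < t) (h1 : t < 1) (a : ℕ → Bool) :
    Summable fun i => (if a i then (1 - t) * t ^ i else 0 : ℝ) :=
  Summable.of_norm_bounded (summable_cantorBound h0 h1) (norm_cantorTerm_le h0 h1 a)

theorem cantorPoint_nonneg {t : ℝ} (h0 : 0 < t) (h1 : t < 1) (a : ℕ → Bool) :
    0 ≤ cantorPoint t a :=
  tsum_nonneg fun i => by
    split_ifs
    · exact mul_nonneg (by linarith) (by positivity)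
    · exact le_rfl

theorem cantorPoint_le_one {t : ℝ} (h0 : 0 < t) (h1 : t < 1) (a : ℕ → Bool) :
    cantorPoint t a ≤ 1 := by
  have h : ∑' i : ℕ, (1 - t) * t ^ i = 1 := by
    rw [tsum_mul_left, tsum_geometric_of_lt_one h0.le h1,
      mul_inv_cancel₀ (by linarith : (1 - t) ≠ 0)]
  rw [← h]
  exact (summable_cantorTerm h0 h1 a).tsum_le_tsum
    (fun i => (le_abs_self _).trans (norm_cantorTerm_le h0 h1 a i)) (summable_cantorBound h0 h1)

theorem cantorMap_injective {t : ℝ} (h0 : 0 < t) (b : Bool) : Function.Injective (cantorMap t b) :=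
  fun _ _ h => mul_left_cancel₀ h0.ne' (add_right_cancel h)

/-- For `t < 1 / 2` the intervals `[0, t]` and `[1 - t, 1]` are disjoint, so a point determines its
first letter; the later letters follow by induction. -/
theorem cantorPoint_injective {t : ℝ} (h0 : 0 < t) (h2 : t < 1 / 2) :
    Function.Injective (cantorPoint t) := by
  have h1 : t < 1 := by linarith
  have head : ∀ a b : ℕ → Bool, cantorPoint t a = cantorPoint t b → a 0 = b 0 := by
    intro a b h
    rw [cantorPoint_eq h0 h1 a, cantorPoint_eq h0 h1 b] at h
    have ha := cantorPoint_nonneg h0 h1 fun i => a (i + 1)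
    have hb := cantorPoint_nonneg h0 h1 fun i => b (i + 1)
    have ha' := cantorPoint_le_one h0 h1 fun i => a (i + 1)
    have hb' := cantorPoint_le_one h0 h1 fun i => b (i + 1)
    cases hA : a 0 <;> cases hB : b 0 <;> simp only [hA, hB, cantorMap] at h ⊢ <;>
      simp only [Bool.false_eq_true, if_true, if_false] at h <;> nlinarith
  have key : ∀ i (a b : ℕ → Bool), cantorPoint t a = cantorPoint t b → a i = b i := by
    intro i
    induction i with
    | zero => exact head
    | succ i ih =>
      intro a b h
      have h' := head a b h
      rw [cantorPoint_eq h0 h1 a, cantorPoint_eq h0 h1 b, h'] at h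
      exact ih _ _ (cantorMap_injective h0 _ h)
  exact fun a b h => funext fun i => key i a b h

theorem cantorPoint_cons {t : ℝ} (h0 : 0 < t) (h1 : t < 1) (b : Bool) (a : ℕ → Bool) :
    cantorPoint t (fun i => Nat.casesOn i b a) = cantorMap t b (cantorPoint t a) :=
  cantorPoint_eq h0 h1 _

theorem cantorCell_subset {t : ℝ} (h0 : 0 < t) (h1 : t < 1) (l : List Bool) :
    cantorCell t l ⊆ cantorK t := by
  induction l with
  | nil => exact Subset.rfl
  | cons b l ih =>
    rintro _ ⟨y, hy, rfl⟩
    obtain ⟨a, rfl⟩ := ih hy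
    exact ⟨_, cantorPoint_cons h0 h1 b a⟩

theorem cantorPoint_mem_cell_iff {t : ℝ} (h0 : 0 < t) (h2 : t < 1 / 2) (l : List Bool) :
    ∀ a : ℕ → Bool, cantorPoint t a ∈ cantorCell t l ↔ ∀ i (h : i < l.length), a i = l[i] := by
  have h1 : t < 1 := by linarith
  induction l with
  | nil => exact fun a => ⟨fun _ i h => absurd h (Nat.not_lt_zero i), fun _ => mem_range_self a⟩
  | cons b l ih =>
    intro a
    constructor
    · rintro ⟨y, hy, h⟩
      obtain ⟨a', rfl⟩ := cantorCell_subset h0 h1 l hy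
      rw [← cantorPoint_cons h0 h1] at h
      rw [← cantorPoint_injective h0 h2 h]
      rintro (_ | i) hi
      · rfl
      · exact (ih a').1 hy i (by simpa using hi)
    · intro h
      refine ⟨cantorPoint t fun i => a (i + 1), (ih _).2 fun i hi => ?_, ?_⟩
      · exact h (i + 1) (by simpa using hi)
      · rw [cantorPoint_eq h0 h1 a, h 0 (by simp)]
        rfl

/-- Translates the shift in `wormholeRel` into the change of a single letter. -/
theorem cantorPoint_update {t : ℝ} (h0 : 0 < t) (h1 : t < 1) (a : ℕ → Bool) (m : ℕ)
    (ha : a m = false) :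
    cantorPoint t (Function.update a m true) = cantorPoint t a + t ^ m * (1 - t) := by
  rw [← sub_eq_iff_eq_add']
  unfold cantorPoint
  rw [← (summable_cantorTerm h0 h1 _).tsum_sub (summable_cantorTerm h0 h1 _), tsum_eq_single m]
  · simp [ha, mul_comm]
  · intro i hi
    simp [Function.update_of_ne hi]

/-- The infinite address of a point of the Cantor set. -/
def cantorAddress (t : ℝ) (w : cantorK t) : ℕ → Bool := w.2.choose

theorem cantorPoint_address {t : ℝ} (w : cantorK t) : cantorPoint t (cantorAddress t w) = w :=
  w.2.choose_spec

theorem continuous_cantorAddress {t : ℝ} (h0 : 0 < t) (h2 : t < 1 / 2) :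
    Continuous (cantorAddress t) := by
  rw [((continuous_cantorPoint h0 (by linarith)).isClosedEmbedding
    (cantorPoint_injective h0 h2)).isEmbedding.continuous_iff]
  convert continuous_subtype_val using 1
  exact funext cantorPoint_address

/-- The first `n` letters of the address of a point of the Cantor set. -/
def cantorPrefix (t : ℝ) (n : ℕ) (w : cantorK t) : Fin n → Bool := fun i => cantorAddress t w i

theorem continuous_cantorPrefix {t : ℝ} (h0 : 0 < t) (h2 : t < 1 / 2) (n : ℕ) :
    Continuous (cantorPrefix t n) :=
  continuous_pi fun i => (continuous_apply (i : ℕ)).comp (continuous_cantorAddress h0 h2)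

theorem mem_cantorCell_prefix {t : ℝ} (h0 : 0 < t) (h2 : t < 1 / 2) {n : ℕ} (w : cantorK t) :
    (w : ℝ) ∈ cantorCell t (List.ofFn (cantorPrefix t n w)) := by
  rw [← cantorPoint_address w, cantorPoint_mem_cell_iff h0 h2]
  intro i hi
  simp [cantorPrefix]

/-- The identifications at the wormholes of level greater than `n` do not change the first `n`
letters. -/
theorem cantorPrefix_eq_of_wormholeRel {t : ℝ} (h0 : 0 < t) (h2 : t < 1 / 2) {js : ℕ → ℕ} {n : ℕ}
    {z z' : unitInterval × cantorK t} (h : wormholeRel t js z z')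
    (hz : (z.1 : ℝ) ∉ wormholeLocUpTo js n) : cantorPrefix t n z.2 = cantorPrefix t n z'.2 := by
  obtain ⟨l, hl, -, hu, hv⟩ := h
  -- The wormhole has level `l.length + 1 > n`, and the letter it changes has index `l.length`,
  -- counted from zero.
  have hn : n ≤ l.length := by
    by_contra! hn
    exact hz (mem_biUnion (Finset.mem_coe.2 (Finset.mem_Icc.2 ⟨by omega, by omega⟩)) hl)
  rw [← cantorPoint_address z.2, cantorPoint_mem_cell_iff h0 h2] at hu
  have hm := hu l.length (by simp)
  simp only [List.getElem_concat_length] at hm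
  rw [← cantorPoint_address z.2, ← cantorPoint_update h0 (by linarith) _ _ hm,
    ← cantorPoint_address z'.2] at hv
  have := cantorPoint_injective h0 h2 hv
  funext i
  rw [cantorPrefix, cantorPrefix, this, Function.update_of_ne (by omega)]

/-! ### The contraction ratio and the finiteness of the set of wormhole heights of bounded level -/

theorem IsLaaksoData.ratio_lt_half {Q t : ℝ} {j : ℕ} {js : ℕ → ℕ} (hL : IsLaaksoData Q t j js) :
    t < 1 / 2 := by
  obtain ⟨h0, h1⟩ := hL.ratio_mem
  have hpos : 0 < Real.log (1 / t) := Real.log_pos (by rw [lt_div_iff₀ h0]; linarith)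
  have h := hL.dim_eq
  have h2 := hL.dim_lt_two
  rw [div_eq_iff hpos.ne'] at h
  have : Real.log 2 < Real.log (1 / t) := by nlinarith
  have := (Real.log_lt_log_iff (by norm_num) (by positivity)).1 this
  rw [lt_div_iff₀ h0] at this
  linarith

theorem finite_wormholeLoc (js : ℕ → ℕ) (l : ℕ) : (wormholeLoc js l).Finite := by
  refine ((Set.Finite.pi' (t := fun i : Fin l => Iio (js (i + 1))) fun i =>
    finite_Iio _).image fun m => ∑ i ∈ Finset.Icc 1 l,
      ((if h : i - 1 < l then m ⟨i - 1, h⟩ else 0 : ℕ) : ℝ) *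
        ∏ h ∈ Finset.Icc 1 i, (js h : ℝ)⁻¹).subset ?_
  rintro x ⟨m, hm, -, rfl⟩
  refine ⟨fun i => m (i + 1), fun i => hm _ (Finset.mem_Icc.2 ⟨by omega, by omega⟩),
    Finset.sum_congr rfl fun i hi => ?_⟩
  obtain ⟨h1, h2⟩ := Finset.mem_Icc.1 hi
  simp [show i - 1 < l by omega, show i - 1 + 1 = i by omega]

theorem finite_wormholeLocUpTo (js : ℕ → ℕ) (n : ℕ) : (wormholeLocUpTo js n).Finite :=
  (Finset.finite_toSet _).biUnion fun l _ => finite_wormholeLoc js l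

/-! ### The geodesic distance along horizontal segments -/

theorem ofReal_abs_height_sub_le_geodesicDist {t : ℝ} {js : ℕ → ℕ} (p q : LaaksoQuot t js) :
    ENNReal.ofReal |height t js p - height t js q| ≤ geodesicDist p q := by
  refine le_iInf fun γ => ?_
  have h := eVariationOn.edist_le (fun s : ℝ => height t js (γ.extend s))
    (left_mem_Icc.2 zero_le_one) (right_mem_Icc.2 (zero_le_one' ℝ))
  rw [edist_dist, Real.dist_eq, Path.extend_zero, Path.extend_one] at h
  exact h

theorem ofReal_abs_height_sub_le {t : ℝ} {js : ℕ → ℕ} (p q : Laakso t js) :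
    ENNReal.ofReal |height t js p - height t js q| ≤ edist p q :=
  ofReal_abs_height_sub_le_geodesicDist p q

theorem abs_height_sub_le {t : ℝ} {js : ℕ → ℕ} {p q : Laakso t js} {c : ℝ} (hc : 0 ≤ c)
    (h : edist p q ≤ ENNReal.ofReal c) : |height t js p - height t js q| ≤ c :=
  (ENNReal.ofReal_le_ofReal_iff hc).1 ((ofReal_abs_height_sub_le p q).trans h)

/-- The straight segment has monotone height, so its length is the height difference. -/
theorem edist_laaksoMap_le {t : ℝ} {js : ℕ → ℕ} {x y : unitInterval} (hxy : x ≤ y)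
    (w : cantorK t) :
    edist (laaksoMap t js (x, w)) (laaksoMap t js (y, w)) ≤ ENNReal.ofReal (y - x) := by
  have hxy' : (x : ℝ) ≤ y := hxy
  let γ : Path (X := LaaksoQuot t js) (Quot.mk _ (x, w)) (Quot.mk _ (y, w)) :=
    { toFun := fun s => Quot.mk _ (projIcc 0 1 zero_le_one ((x : ℝ) + s * (y - x)), w)
      continuous_toFun := continuous_quot_mk.comp <| by
        refine (continuous_projIcc.comp ?_).prodMk continuous_const
        fun_prop
      source' := by simp
      target' := by simp }
  refine iInf_le_of_le γ ?_
  have hmono : MonotoneOn (fun s : ℝ => height t js (γ.extend s)) (Icc 0 1) := by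
    intro a ha b hb hab
    beta_reduce
    rw [γ.extend_apply ha, γ.extend_apply hb]
    change ((projIcc (0 : ℝ) 1 zero_le_one _ : unitInterval) : ℝ) ≤ (projIcc (0 : ℝ) 1 zero_le_one _ : unitInterval)
    refine Subtype.coe_le_coe.2 (monotone_projIcc (zero_le_one' ℝ) ?_)
    have := mul_le_mul_of_nonneg_right hab (sub_nonneg.2 hxy')
    linarith
  have h := hmono.eVariationOn_eq (left_mem_Icc.2 zero_le_one) (right_mem_Icc.2 zero_le_one)
  rw [inter_self] at h
  refine h.le.trans (le_of_eq ?_)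
  rw [Path.extend_zero, Path.extend_one]
  rfl

theorem edist_laaksoMap {t : ℝ} {js : ℕ → ℕ} (x y : unitInterval) (w : cantorK t) :
    edist (laaksoMap t js (x, w)) (laaksoMap t js (y, w)) = edist (x : ℝ) y := by
  have h : ENNReal.ofReal |(x : ℝ) - y| ≤
      edist (laaksoMap t js (x, w)) (laaksoMap t js (y, w)) := ofReal_abs_height_sub_le _ _
  rw [edist_dist, Real.dist_eq]
  refine le_antisymm ?_ h
  rcases le_total x y with hxy | hxy
  · rw [abs_sub_comm, abs_of_nonneg (sub_nonneg.2 (Subtype.coe_le_coe.2 hxy))]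
    exact edist_laaksoMap_le hxy w
  · rw [edist_comm, abs_of_nonneg (sub_nonneg.2 (Subtype.coe_le_coe.2 hxy))]
    exact edist_laaksoMap_le hxy w

/-! ### Local structure away from the wormholes of level at most `n` -/

/-- A path of length less than `δ` keeps its height within `δ` of `x`. Over this range of heights
the first `n` letters are well defined and locally constant on the quotient, hence constant on the
connected path. -/
theorem exists_mem_cell_of_geodesicDist_lt {t : ℝ} (h0 : 0 < t) (h2 : t < 1 / 2) {js : ℕ → ℕ}
    {n : ℕ} {x : unitInterval} {w : cantorK t} {δ : ℝ} (hδ : 0 < δ)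
    (hball : Metric.ball (x : ℝ) δ ⊆ (wormholeLocUpTo js n)ᶜ) {q : LaaksoQuot t js}
    (hq : geodesicDist q (Quot.mk _ (x, w)) < ENNReal.ofReal δ) :
    ∃ (x' : unitInterval) (w' : cantorK t),
      q = Quot.mk _ (x', w') ∧ cantorPrefix t n w' = cantorPrefix t n w := by
  let J : Set (unitInterval × cantorK t) := {z | (z.1 : ℝ) ∈ Metric.ball (x : ℝ) δ}
  have hJ : IsOpen J := Metric.isOpen_ball.preimage (by fun_prop)
  have hinv : ∀ z z', wormholeRel t js z z' → (z ∈ J ↔ z' ∈ J) := by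
    rintro z z' ⟨-, -, h, -⟩
    simp only [J, mem_ofPred_eq, h]
  have hpre : ∀ z z', wormholeRel t js z z' → z ∈ J →
      cantorPrefix t n z.2 = cantorPrefix t n z'.2 := fun z z' h hz =>
    cantorPrefix_eq_of_wormholeRel h0 h2 h (hball hz)
  -- The points over the ball whose first `n` letters satisfy `P`. Both conditions respect the
  -- gluing, so this is a set in the quotient, open because its preimage is.
  let A (P : (Fin n → Bool) → Prop) : Set (LaaksoQuot t js) :=
    {q | Quot.lift (fun z => z ∈ J ∧ P (cantorPrefix t n z.2)) (fun z z' h => by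
      refine propext ?_
      rw [← hinv z z' h]
      exact and_congr_right fun hz => by rw [hpre z z' h hz]) q}
  have hA : ∀ P, IsOpen (A P) := fun P => by
    refine isOpen_coinduced.2 (hJ.inter ?_)
    exact (isOpen_discrete {b | P b}).preimage
      ((continuous_cantorPrefix h0 h2 n).comp continuous_snd)
  obtain ⟨γ, hγ⟩ := iInf_lt_iff.1 hq
  have hrange : range γ ⊆ A (· = cantorPrefix t n w) ∪ A (· ≠ cantorPrefix t n w) := by
    rintro _ ⟨s, rfl⟩
    have h := (eVariationOn.edist_le (fun s : ℝ => height t js (γ.extend s)) s.2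
      (right_mem_Icc.2 (zero_le_one' ℝ))).trans_lt hγ
    rw [Path.extend_one, Path.extend_apply γ s.2, edist_dist,
      ENNReal.ofReal_lt_ofReal_iff hδ] at h
    obtain ⟨z, hz⟩ := Quot.exists_rep (γ s)
    change dist (height t js (γ s)) x < δ at h
    rw [← hz] at h ⊢
    by_cases hp : cantorPrefix t n z.2 = cantorPrefix t n w
    · exact Or.inl ⟨h, hp⟩
    · exact Or.inr ⟨h, hp⟩
  have hdisj : Disjoint (A (· = cantorPrefix t n w)) (A (· ≠ cantorPrefix t n w)) := by
    rw [Set.disjoint_left]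
    intro q
    induction q using Quot.ind
    exact fun h h' => h'.2 h.2
  have hw : (Quot.mk _ (x, w) : LaaksoQuot t js) ∈ A (· = cantorPrefix t n w) :=
    ⟨Metric.mem_ball_self hδ, rfl⟩
  have hmem := (isPreconnected_range γ.continuous).subset_left_of_subset_union
    (hA (· = cantorPrefix t n w)) (hA (· ≠ cantorPrefix t n w)) hdisj hrange
    ⟨_, ⟨1, γ.target⟩, hw⟩ ⟨0, rfl⟩
  rw [γ.source] at hmem
  obtain ⟨z, rfl⟩ := Quot.exists_rep q
  exact ⟨z.1, z.2, rfl, hmem.2⟩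

/-- Near a point whose height is not the location of a wormhole of level at most `n`, the geodesic
distance does not see the other cells of depth `n`. -/
theorem eventually_mem_cell {t : ℝ} (h0 : 0 < t) (h2 : t < 1 / 2) {js : ℕ → ℕ} {n : ℕ}
    {x : unitInterval} {w : cantorK t} (hx : (x : ℝ) ∉ wormholeLocUpTo js n) :
    ∀ᶠ q in 𝓝 (laaksoMap t js (x, w)), ∃ (x' : unitInterval) (w' : cantorK t),
      q = laaksoMap t js (x', w') ∧ cantorPrefix t n w' = cantorPrefix t n w := by
  obtain ⟨δ, hδ, hball⟩ :=
    Metric.isOpen_iff.1 (finite_wormholeLocUpTo js n).isClosed.isOpen_compl (x : ℝ) hx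
  filter_upwards [Metric.eball_mem_nhds _ (ENNReal.ofReal_pos.2 hδ)] with q hq
  exact exists_mem_cell_of_geodesicDist_lt h0 h2 hδ hball hq

/-! ### The horizontal derivative of a function of class `𝒢_n` -/

theorem pullback_projIcc {t : ℝ} {js : ℕ → ℕ} (f : Laakso t js → ℝ) (w : cantorK t) (x : ℝ) :
    pullback f w (projIcc (0 : ℝ) 1 zero_le_one x) = pullback f w x := by
  simp only [pullback, projIcc_val]

theorem pullback_eq_of_prefix_eq {t : ℝ} (h0 : 0 < t) (h2 : t < 1 / 2) {js : ℕ → ℕ} {n : ℕ}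
    {f : C(Laakso t js, ℝ)} (hf : f ∈ classG t js n) {w w' : cantorK t}
    (h : cantorPrefix t n w = cantorPrefix t n w') : pullback f w = pullback f w' := by
  funext x
  rw [← pullback_projIcc f w, ← pullback_projIcc f w']
  exact hf.1 _ (projIcc (0 : ℝ) 1 zero_le_one x).2 _ (List.length_ofFn (f := cantorPrefix t n w))
    w w' (mem_cantorCell_prefix h0 h2 w) (h ▸ mem_cantorCell_prefix h0 h2 w')

/-- The derivative of `f̂ (·, w)`, with the value `0` at the locations of the wormholes of level at
most `n`. -/
def horizontalDeriv {t : ℝ} {js : ℕ → ℕ} (f : Laakso t js → ℝ) (n : ℕ) (w : cantorK t) : ℝ → ℝ :=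
  (Icc 0 1 \ wormholeLocUpTo js n).indicator (derivWithin (pullback f w) (Icc 0 1))

theorem horizontalDeriv_of_mem {t : ℝ} {js : ℕ → ℕ} (f : Laakso t js → ℝ) {n : ℕ} (w : cantorK t)
    {x : ℝ} (hx : x ∈ wormholeLocUpTo js n) : horizontalDeriv f n w x = 0 :=
  indicator_of_notMem (fun h => h.2 hx) _

theorem diff_wormholeLocUpTo_mem_nhdsWithin {js : ℕ → ℕ} {n : ℕ} {x : ℝ}
    (hx : x ∉ wormholeLocUpTo js n) : Icc (0 : ℝ) 1 \ wormholeLocUpTo js n ∈ 𝓝[Icc 0 1] x :=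
  inter_mem self_mem_nhdsWithin (mem_nhdsWithin_of_mem_nhds
    ((finite_wormholeLocUpTo js n).isClosed.isOpen_compl.mem_nhds hx))

theorem hasDerivWithinAt_pullback {t : ℝ} {js : ℕ → ℕ} {n : ℕ} {f : C(Laakso t js, ℝ)}
    (hf : f ∈ classG t js n) (w : cantorK t) {x : ℝ}
    (hx : x ∈ Icc (0 : ℝ) 1 \ wormholeLocUpTo js n) :
    HasDerivWithinAt (pullback f w) (horizontalDeriv f n w x) (Icc 0 1) x := by
  rw [horizontalDeriv, indicator_of_mem hx]
  refine DifferentiableWithinAt.hasDerivWithinAt ?_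
  exact (((hf.2 w).1.differentiableOn one_ne_zero) x hx).mono_of_mem_nhdsWithin
    (diff_wormholeLocUpTo_mem_nhdsWithin hx.2)

theorem continuousOn_derivWithin_pullback {t : ℝ} {js : ℕ → ℕ} {n : ℕ} {f : C(Laakso t js, ℝ)}
    (hf : f ∈ classG t js n) (w : cantorK t) :
    ContinuousOn (derivWithin (pullback f w) (Icc 0 1)) (Icc 0 1 \ wormholeLocUpTo js n) := by
  have hu : UniqueDiffOn ℝ (Icc (0 : ℝ) 1 \ wormholeLocUpTo js n) :=
    (uniqueDiffOn_Icc zero_lt_one).inter (finite_wormholeLocUpTo js n).isClosed.isOpen_compl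
  refine ((hf.2 w).1.continuousOn_derivWithin hu le_rfl).congr fun x hx => ?_
  exact (derivWithin_of_mem_nhdsWithin (diff_wormholeLocUpTo_mem_nhdsWithin hx.2)
    (uniqueDiffOn_Icc zero_lt_one x hx.1)
    ((hasDerivWithinAt_pullback hf w hx).differentiableWithinAt.mono sdiff_subset))

theorem measurable_horizontalDeriv {t : ℝ} {js : ℕ → ℕ} {n : ℕ} {f : C(Laakso t js, ℝ)}
    (hf : f ∈ classG t js n) (w : cantorK t) : Measurable (horizontalDeriv f n w) := by
  classical
  have hm : MeasurableSet (Icc (0 : ℝ) 1 \ wormholeLocUpTo js n) :=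
    measurableSet_Icc.diff (finite_wormholeLocUpTo js n).measurableSet
  rw [horizontalDeriv, ← piecewise_eq_indicator]
  exact (continuousOn_derivWithin_pullback hf w).measurable_piecewise continuousOn_const hm

/-- Compactness of `[0, 1]`: the derivative is locally bounded, by its one-sided limits at a
wormhole height and by continuity elsewhere. -/
theorem exists_bound_horizontalDeriv_single {t : ℝ} {js : ℕ → ℕ} {n : ℕ} {f : C(Laakso t js, ℝ)}
    (hf : f ∈ classG t js n) (w : cantorK t) :
    ∃ C : ℝ, ∀ x, |horizontalDeriv f n w x| ≤ C := by
  set W := wormholeLocUpTo js n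
  set D := derivWithin (pullback f w) (Icc 0 1)
  have hloc : ∀ y ∈ Icc (0 : ℝ) 1, ∃ s ∈ 𝓝[Icc 0 1] y, ∃ C : ℝ, ∀ x ∈ s \ W, |D x| ≤ C := by
    intro y hy
    suffices h : ∃ C : ℝ, ∀ᶠ x in 𝓝[Icc 0 1 \ W] y, |D x| ≤ C by
      obtain ⟨C, hC⟩ := h
      obtain ⟨u, hu, hyu, h⟩ := eventually_nhdsWithin_iff.1 hC |> eventually_nhds_iff.1
      exact ⟨u ∩ Icc 0 1, inter_mem (mem_nhdsWithin_of_mem_nhds (hyu.mem_nhds h))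
        self_mem_nhdsWithin, C, fun x hx => hu x hx.1.1 ⟨hx.1.2, hx.2⟩⟩
    by_cases hyW : y ∈ W
    · obtain ⟨⟨c, hc⟩, c', hc'⟩ := (hf.2 w).2 y hyW
      have hb : ∀ {l : Filter ℝ} {c : ℝ}, Tendsto (deriv (pullback f w)) l (𝓝 c) →
          ∀ᶠ x in l, |deriv (pullback f w) x| ≤ |c| + 1 := fun h =>
        (h.abs.eventually (gt_mem_nhds (lt_add_one _))).mono fun _ => le_of_lt
      have hne : ∀ᶠ x in 𝓝[≠] y, |deriv (pullback f w) x| ≤ max (|c| + 1) (|c'| + 1) := by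
        rw [← nhdsLT_sup_nhdsGT, eventually_sup]
        exact ⟨(hb hc).mono fun _ h => h.trans (le_max_left _ _),
          (hb hc').mono fun _ h => h.trans (le_max_right _ _)⟩
      -- The limits concern `deriv`, which is known to agree with `derivWithin` on `[0, 1]` only in
      -- the interior, so the end points are kept out.
      have hends : ∀ᶠ x in 𝓝[≠] y, x ∈ ({0, 1} : Set ℝ)ᶜ := by
        have : (({0, 1} : Set ℝ) \ {y})ᶜ ∈ 𝓝 y :=
          ((toFinite _).isClosed.isOpen_compl).mem_nhds (by simp)
        filter_upwards [mem_nhdsWithin_of_mem_nhds this, self_mem_nhdsWithin] with x h1 h2 h3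
        exact h1 ⟨h3, h2⟩
      have hsub : Icc 0 1 \ W ⊆ {y}ᶜ := fun x hx hxy => hx.2 (hxy ▸ hyW)
      refine ⟨max (|c| + 1) (|c'| + 1), ?_⟩
      filter_upwards [(hne.and hends).filter_mono (nhdsWithin_mono y hsub),
        self_mem_nhdsWithin] with x
      · rintro ⟨h1, h2⟩ ⟨h3, -⟩
        simp only [mem_compl_iff, mem_insert_iff, mem_singleton_iff, not_or] at h2
        have : Icc (0 : ℝ) 1 ∈ 𝓝 x := Icc_mem_nhds (lt_of_le_of_ne h3.1 (Ne.symm h2.1))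
          (lt_of_le_of_ne h3.2 h2.2)
        simpa only [D, derivWithin_of_mem_nhds this] using h1
    · exact ⟨|D y| + 1, ((continuousOn_derivWithin_pullback hf w y ⟨hy, hyW⟩).abs.eventually
        (gt_mem_nhds (lt_add_one _))).mono fun _ => le_of_lt⟩
  obtain ⟨C, hC⟩ : ∃ C : ℝ, ∀ x ∈ Icc (0 : ℝ) 1 \ W, |D x| ≤ C := by
    refine isCompact_Icc.induction_on (p := fun s => ∃ C : ℝ, ∀ x ∈ s \ W, |D x| ≤ C) ?_ ?_ ?_ hloc
    · exact ⟨0, by simp⟩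
    · rintro s u hsu ⟨C, hC⟩
      exact ⟨C, fun x hx => hC x ⟨hsu hx.1, hx.2⟩⟩
    · rintro s u ⟨C, hC⟩ ⟨C', hC'⟩
      refine ⟨max C C', fun x hx => ?_⟩
      rcases hx.1 with h | h
      · exact (hC x ⟨h, hx.2⟩).trans (le_max_left _ _)
      · exact (hC' x ⟨h, hx.2⟩).trans (le_max_right _ _)
  refine ⟨max C 0, fun x => ?_⟩
  rw [horizontalDeriv]
  by_cases hx : x ∈ Icc (0 : ℝ) 1 \ W
  · rw [indicator_of_mem hx]
    exact (hC x hx).trans (le_max_left _ _)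
  · rw [indicator_of_notMem hx]
    simp

/-- The point of the Cantor set whose address consists of a given finite word followed by
zeros. -/
def cantorBase (t : ℝ) {n : ℕ} (b : Fin n → Bool) : cantorK t :=
  ⟨cantorPoint t fun i => if h : i < n then b ⟨i, h⟩ else false, mem_range_self _⟩

/-- Reduces statements about all `w` to the finitely many base points; this gives the uniform bound,
the measurability of the slope and the finite set of exceptional values. -/
theorem cantorPrefix_base {t : ℝ} (h0 : 0 < t) (h2 : t < 1 / 2) {n : ℕ} (b : Fin n → Bool) :
    cantorPrefix t n (cantorBase t b) = b := by
  have h := cantorPoint_injective h0 h2 (cantorPoint_address (cantorBase t b))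
  funext i
  rw [cantorPrefix, h]
  simp

theorem horizontalDeriv_eq_of_prefix_eq {t : ℝ} (h0 : 0 < t) (h2 : t < 1 / 2) {js : ℕ → ℕ} {n : ℕ}
    {f : C(Laakso t js, ℝ)} (hf : f ∈ classG t js n) {w w' : cantorK t}
    (h : cantorPrefix t n w = cantorPrefix t n w') :
    horizontalDeriv f n w = horizontalDeriv f n w' := by
  rw [horizontalDeriv, horizontalDeriv, pullback_eq_of_prefix_eq h0 h2 hf h]

theorem exists_bound_horizontalDeriv {t : ℝ} (h0 : 0 < t) (h2 : t < 1 / 2) {js : ℕ → ℕ} {n : ℕ}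
    {f : C(Laakso t js, ℝ)} (hf : f ∈ classG t js n) :
    ∃ C : ℝ, 0 ≤ C ∧ ∀ w x, |horizontalDeriv f n w x| ≤ C := by
  choose C hC using fun b : Fin n → Bool => exists_bound_horizontalDeriv_single hf (cantorBase t b)
  have hC0 : ∀ b, 0 ≤ C b := fun b => (abs_nonneg _).trans (hC b 0)
  refine ⟨∑ b, C b, Finset.sum_nonneg fun b _ => hC0 b, fun w x => ?_⟩
  rw [horizontalDeriv_eq_of_prefix_eq h0 h2 hf (cantorPrefix_base h0 h2 _).symm]
  exact (hC _ x).trans (Finset.single_le_sum (fun b _ => hC0 b) (Finset.mem_univ _))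

/-- The absolute value of the horizontal derivative, as a function on the Laakso space. -/
def horizontalSlope {t : ℝ} (h0 : 0 < t) (h2 : t < 1 / 2) {js : ℕ → ℕ} {n : ℕ}
    {f : C(Laakso t js, ℝ)} (hf : f ∈ classG t js n) : Laakso t js → ℝ≥0∞ :=
  Quot.lift (fun z => ENNReal.ofReal |horizontalDeriv f n z.2 z.1|) fun z z' h => by
    -- At these heights the derivatives along the two glued fibres may differ; the default value `0`
    -- makes them agree.
    by_cases hz : (z.1 : ℝ) ∈ wormholeLocUpTo js n
    · have hz' : (z'.1 : ℝ) ∈ wormholeLocUpTo js n := by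
        obtain ⟨-, -, h, -⟩ := h
        rwa [h]
      rw [horizontalDeriv_of_mem _ _ hz, horizontalDeriv_of_mem _ _ hz']
    · rw [horizontalDeriv_eq_of_prefix_eq h0 h2 hf (cantorPrefix_eq_of_wormholeRel h0 h2 h hz)]
      obtain ⟨-, -, h, -⟩ := h
      rw [h]

theorem horizontalSlope_laaksoMap {t : ℝ} (h0 : 0 < t) (h2 : t < 1 / 2) {js : ℕ → ℕ} {n : ℕ}
    {f : C(Laakso t js, ℝ)} (hf : f ∈ classG t js n) (x : unitInterval) (w : cantorK t) :
    horizontalSlope h0 h2 hf (laaksoMap t js (x, w)) =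
      ENNReal.ofReal |horizontalDeriv f n w x| := rfl

theorem measurable_laaksoMap (t : ℝ) (js : ℕ → ℕ) : Measurable (laaksoMap t js) :=
  fun _ hs => hs

theorem measurable_horizontalSlope {t : ℝ} (h0 : 0 < t) (h2 : t < 1 / 2) {js : ℕ → ℕ} {n : ℕ}
    {f : C(Laakso t js, ℝ)} (hf : f ∈ classG t js n) : Measurable (horizontalSlope h0 h2 hf) := by
  -- The σ-algebra on `L` is pushed forward along `ι`, so only the pullback matters. It factors
  -- through `I` times the finite set of words of length `n`.
  suffices h : Measurable fun z : unitInterval × cantorK t =>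
      ENNReal.ofReal |horizontalDeriv f n z.2 z.1| from fun s hs => h hs
  have hH : Measurable fun z : unitInterval × (Fin n → Bool) =>
      ENNReal.ofReal |horizontalDeriv f n (cantorBase t z.2) z.1| :=
    measurable_from_prod_countable_left fun b =>
      ((measurable_horizontalDeriv hf (cantorBase t b)).comp
        (measurable_subtype_coe (p := (· ∈ unitInterval)))).norm.ennreal_ofReal
  have h := hH.comp (measurable_fst.prodMk
    ((continuous_cantorPrefix h0 h2 n).measurable.comp measurable_snd))
  refine (congrArg Measurable (funext fun z => ?_)).mp h
  change ENNReal.ofReal |horizontalDeriv f n (cantorBase t (cantorPrefix t n z.2)) z.1| = _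
  rw [horizontalDeriv_eq_of_prefix_eq h0 h2 hf (cantorPrefix_base h0 h2 _)]

instance isFiniteMeasure_cantorMeasure (t : ℝ) : IsFiniteMeasure (cantorMeasure t) :=
  Measure.isFiniteMeasure_map _ _

theorem lintegral_horizontalSlope_lt_top {t : ℝ} (h0 : 0 < t) (h2 : t < 1 / 2) {js : ℕ → ℕ}
    {n : ℕ} {f : C(Laakso t js, ℝ)} (hf : f ∈ classG t js n) {r : ℝ} (hr : 0 ≤ r) :
    ∫⁻ q, horizontalSlope h0 h2 hf q ^ r ∂laaksoMeasure t js < ∞ := by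
  obtain ⟨C, -, hC⟩ := exists_bound_horizontalDeriv h0 h2 hf
  have : IsFiniteMeasure (laaksoMeasure t js) := Measure.isFiniteMeasure_map _ _
  refine (lintegral_mono (g := fun _ => ENNReal.ofReal C ^ r) fun q => ?_).trans_lt ?_
  · obtain ⟨z, rfl⟩ := Quot.exists_rep q
    exact ENNReal.rpow_le_rpow (ENNReal.ofReal_le_ofReal (hC _ _)) hr
  · rw [lintegral_const]
    exact ENNReal.mul_lt_top (ENNReal.rpow_lt_top_of_nonneg hr ENNReal.ofReal_ne_top)
      (measure_lt_top _ _)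

/-! ### Arc length integrals along curves of constant speed -/

theorem eVariationOn_eq_of_edist_eq {α E F : Type*} [LinearOrder α] [PseudoEMetricSpace E]
    [PseudoEMetricSpace F] {γ : α → E} {φ : α → F} {s : Set α}
    (h : ∀ x ∈ s, ∀ y ∈ s, edist (γ x) (γ y) = edist (φ x) (φ y)) :
    eVariationOn γ s = eVariationOn φ s :=
  iSup_congr fun p => Finset.sum_congr rfl fun _ _ => h _ (p.2.2.2 _) _ (p.2.2.2 _)

section ConstantSpeed

variable {X : Type*} [PseudoEMetricSpace X] {γ : ℝ → X} {c : ℝ}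

theorem eVariationOn_of_edist_eq_mul (hc : 0 < c)
    (h : ∀ x ∈ Icc (0 : ℝ) 1, ∀ y ∈ Icc (0 : ℝ) 1, edist (γ x) (γ y) = edist (c * x) (c * y))
    {y : ℝ} (hy : y ∈ Icc (0 : ℝ) 1) :
    eVariationOn γ (Icc 0 1 ∩ Icc 0 y) = ENNReal.ofReal (c * y) := by
  have hm : MonotoneOn (fun x : ℝ => c * x) (Icc 0 1) := fun _ _ _ _ hab =>
    mul_le_mul_of_nonneg_left hab hc.le
  rw [eVariationOn_eq_of_edist_eq (φ := fun x => c * x) fun x hx y hy => h x hx.1 y hy.1,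
    hm.eVariationOn_eq (left_mem_Icc.2 zero_le_one) hy]
  simp

theorem eVariationOn_Icc_of_edist_eq_mul (hc : 0 < c)
    (h : ∀ x ∈ Icc (0 : ℝ) 1, ∀ y ∈ Icc (0 : ℝ) 1, edist (γ x) (γ y) = edist (c * x) (c * y)) :
    eVariationOn γ (Icc 0 1) = ENNReal.ofReal c := by
  have := eVariationOn_of_edist_eq_mul hc h (right_mem_Icc.2 zero_le_one)
  rwa [inter_self, mul_one] at this

theorem isRectifiable_of_edist_eq_mul (hc : 0 < c)
    (h : ∀ x ∈ Icc (0 : ℝ) 1, ∀ y ∈ Icc (0 : ℝ) 1, edist (γ x) (γ y) = edist (c * x) (c * y)) :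
    IsRectifiable γ := by
  refine ⟨LipschitzOnWith.continuousOn (K := c.toNNReal) fun x hx y hy => ?_, ?_⟩
  · rw [h x hx y hy, edist_dist, edist_dist, Real.dist_eq, Real.dist_eq, ← mul_sub, abs_mul,
      abs_of_pos hc, ENNReal.ofReal_mul hc.le]
    rfl
  · rw [eVariationOn_Icc_of_edist_eq_mul hc h]
    exact ENNReal.ofReal_ne_top

/-- The arc length function is `y ↦ c * y`. It is injective, so the choice in the definition of the
natural parameterization is forced. -/
theorem naturalParameterization_of_edist_eq_mul (hc : 0 < c)
    (h : ∀ x ∈ Icc (0 : ℝ) 1, ∀ y ∈ Icc (0 : ℝ) 1, edist (γ x) (γ y) = edist (c * x) (c * y))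
    {s : ℝ} (hs : s ∈ Icc 0 c) : naturalParameterization γ (Icc 0 1) 0 s = γ (s / c) := by
  have hV : ∀ y ∈ Icc (0 : ℝ) 1, variationOnFromTo γ (Icc 0 1) 0 y = c * y := fun y hy => by
    rw [variationOnFromTo.eq_of_le _ _ hy.1, eVariationOn_of_edist_eq_mul hc h hy,
      ENNReal.toReal_ofReal (mul_nonneg hc.le hy.1)]
  have hmem : s / c ∈ Icc (0 : ℝ) 1 := ⟨div_nonneg hs.1 hc.le, (div_le_one hc).2 hs.2⟩
  obtain ⟨h1, h2⟩ := Function.invFunOn_pos (f := variationOnFromTo γ (Icc 0 1) 0)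
    (s := Icc 0 1) (b := s) ⟨s / c, hmem, by rw [hV _ hmem, mul_div_cancel₀ _ hc.ne']⟩
  rw [hV _ h1] at h2
  exact congrArg γ (eq_div_of_mul_eq hc.ne' (by rw [mul_comm, h2]))

theorem arcIntegral_of_edist_eq_mul (hc : 0 < c)
    (h : ∀ x ∈ Icc (0 : ℝ) 1, ∀ y ∈ Icc (0 : ℝ) 1, edist (γ x) (γ y) = edist (c * x) (c * y))
    (g : X → ℝ≥0∞) : arcIntegral g γ = ∫⁻ s in Icc 0 c, g (γ (s / c)) := by
  rw [arcIntegral, eVariationOn_Icc_of_edist_eq_mul hc h, ENNReal.toReal_ofReal hc.le]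
  exact setLIntegral_congr_fun measurableSet_Icc fun s hs => by
    rw [naturalParameterization_of_edist_eq_mul hc h hs]

end ConstantSpeed

/-! ### Generalized upper gradients along horizontal segments -/

theorem ofReal_abs_pullback_sub_le {t : ℝ} {js : ℕ → ℕ} {u : Laakso t js → ℝ}
    {g : Laakso t js → ℝ≥0∞} (hg : IsGeneralizedUpperGradient u g) (w : cantorK t) {a b : ℝ}
    (ha : 0 ≤ a) (hab : a < b) (hb : b ≤ 1) :
    ENNReal.ofReal |pullback u w a - pullback u w b| ≤
      ∫⁻ x in Icc a b, g (laaksoMap t js (projIcc 0 1 zero_le_one x, w)) := by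
  let γ : ℝ → Laakso t js := fun s =>
    laaksoMap t js (projIcc 0 1 zero_le_one (a + (b - a) * s), w)
  have hc : 0 < b - a := sub_pos.2 hab
  have hγ : ∀ x ∈ Icc (0 : ℝ) 1, ∀ y ∈ Icc (0 : ℝ) 1,
      edist (γ x) (γ y) = edist ((b - a) * x) ((b - a) * y) := by
    have hmem : ∀ x ∈ Icc (0 : ℝ) 1, a + (b - a) * x ∈ Icc (0 : ℝ) 1 := fun x hx =>
      ⟨by nlinarith [hx.1], by nlinarith [hx.2]⟩
    intro x hx y hy
    simp only [γ, edist_laaksoMap, projIcc_of_mem _ (hmem x hx), projIcc_of_mem _ (hmem y hy),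
      edist_add_left]
  have h := hg.2 γ (isRectifiable_of_edist_eq_mul hc hγ)
  rw [arcIntegral_of_edist_eq_mul hc hγ] at h
  have hm : Measurable fun x : ℝ => g (laaksoMap t js (projIcc 0 1 zero_le_one x, w)) :=
    hg.1.comp ((measurable_laaksoMap t js).comp
      (continuous_projIcc.measurable.prodMk measurable_const))
  have hshift := (measurePreserving_add_left volume a).setLIntegral_comp_preimage
    (measurableSet_Icc (a := a) (b := b)) hm
  rw [preimage_const_add_Icc, sub_self] at hshift
  rw [← hshift]
  convert h using 2
  · simp [γ, pullback]
  · refine funext fun s => ?_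
    simp only [γ, mul_div_cancel₀ _ hc.ne']

/-- By Lebesgue differentiation the indefinite integral of `h` has derivative `h` almost everywhere,
and its right difference quotients dominate those of `F` in absolute value. -/
theorem ae_abs_deriv_le_of_forall_abs_sub_le_lintegral {F : ℝ → ℝ} {h : ℝ → ℝ≥0∞}
    (hm : Measurable h) (hfin : ∫⁻ x in Icc 0 1, h x < ∞)
    (hF : ∀ a b, 0 ≤ a → a < b → b ≤ 1 → ENNReal.ofReal |F a - F b| ≤ ∫⁻ x in Icc a b, h x) :
    ∀ᵐ x, x ∈ Ioo (0 : ℝ) 1 → ∀ D, HasDerivAt F D x → ENNReal.ofReal |D| ≤ h x := by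
  have hint : IntegrableOn (fun x => (h x).toReal) (Icc 0 1) :=
    integrable_toReal_of_lintegral_ne_top hm.aemeasurable hfin.ne
  have hII : IntervalIntegrable (fun x => (h x).toReal) volume 0 1 :=
    (intervalIntegrable_iff_integrableOn_Icc_of_le zero_le_one).2 hint
  filter_upwards [hII.ae_hasDerivAt_integral] with x hx hx01 D hD
  rw [uIcc_of_le zero_le_one] at hx
  have hG := hx (Ioo_subset_Icc_self hx01) 0 (left_mem_Icc.2 zero_le_one)
  refine (ENNReal.ofReal_le_ofReal ?_).trans (ENNReal.ofReal_toReal_le (a := h x))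
  have hle : 𝓝[>] x ≤ 𝓝[≠] x := nhdsWithin_mono x fun y (hy : x < y) => hy.ne'
  refine le_of_tendsto_of_tendsto ((hasDerivAt_iff_tendsto_slope.1 hD).mono_left hle).abs
    ((hasDerivAt_iff_tendsto_slope.1 hG).mono_left hle) ?_
  filter_upwards [Ioo_mem_nhdsGT hx01.2] with y hy
  have hsub : Icc x y ⊆ Icc 0 1 := Icc_subset_Icc hx01.1.le hy.2.le
  have hfin' : ∫⁻ z in Icc x y, h z < ∞ := (lintegral_mono_set hsub).trans_lt hfin
  have key : |F y - F x| ≤ ∫ z in x..y, (h z).toReal := by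
    rw [intervalIntegral.integral_of_le hy.1.le, ← integral_Icc_eq_integral_Ioc,
      integral_toReal hm.aemeasurable (ae_lt_top hm hfin'.ne), abs_sub_comm]
    exact (ENNReal.ofReal_le_iff_le_toReal hfin'.ne).1 (hF x y hx01.1.le hy.1 hy.2.le)
  have hI : ∀ z ∈ Icc (0 : ℝ) 1, IntervalIntegrable (fun x => (h x).toReal) volume 0 z :=
    fun z hz => hII.mono_set (by
      rw [uIcc_of_le hz.1, uIcc_of_le zero_le_one]; exact Icc_subset_Icc_right hz.2)
  have hpos : 0 < y - x := sub_pos.2 hy.1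
  rw [slope_def_field, slope_def_field, abs_div, abs_of_pos hpos,
    intervalIntegral.integral_interval_sub_left (hI y ⟨hx01.1.le.trans hy.1.le, hy.2.le⟩)
      (hI x (Ioo_subset_Icc_self hx01))]
  exact div_le_div_of_nonneg_right key hpos.le

/-- Puts the Cantor factor first, so that Fubini yields statements for almost every `w` and then
almost every `x`. -/
theorem laaksoMeasure_eq_map_swap (t : ℝ) (js : ℕ → ℕ) :
    laaksoMeasure t js = ((cantorMeasure t).prod (volume : Measure unitInterval)).map
      (laaksoMap t js ∘ Prod.swap) := by
  rw [laaksoMeasure, ← Measure.prod_swap,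
    Measure.map_map (measurable_laaksoMap t js) measurable_swap]

/-- The absolute value of the horizontal derivative is almost everywhere at most any generalized
upper gradient in `L^r`. -/
theorem horizontalSlope_ae_le {t : ℝ} (h0 : 0 < t) (h2 : t < 1 / 2) {js : ℕ → ℕ} {n : ℕ}
    {f : C(Laakso t js, ℝ)} (hf : f ∈ classG t js n) {r : ℝ} (hr : 1 ≤ r)
    {g : Laakso t js → ℝ≥0∞} (hg : IsGeneralizedUpperGradient f g)
    (hgr : ∫⁻ q, g q ^ r ∂laaksoMeasure t js < ∞) :
    horizontalSlope h0 h2 hf ≤ᵐ[laaksoMeasure t js] g := by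
  have hmap : Measurable (laaksoMap t js ∘ Prod.swap) :=
    (measurable_laaksoMap t js).comp measurable_swap
  have hle : MeasurableSet {q | horizontalSlope h0 h2 hf q ≤ g q} :=
    measurableSet_le (measurable_horizontalSlope h0 h2 hf) hg.1
  rw [laaksoMeasure_eq_map_swap, lintegral_map (hg.1.pow_const r) hmap,
    lintegral_prod (fun z => g ((laaksoMap t js ∘ Prod.swap) z) ^ r)
      ((hg.1.pow_const r).comp hmap).aemeasurable] at hgr
  rw [laaksoMeasure_eq_map_swap, EventuallyLE, ae_map_iff hmap.aemeasurable hle]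
  refine (Measure.ae_prod_iff_ae_ae (hmap hle)).2 ?_
  filter_upwards [ae_lt_top ((hg.1.pow_const r).comp hmap).lintegral_prod_right' hgr.ne] with w hw
  let h : ℝ → ℝ≥0∞ := fun x => g (laaksoMap t js (projIcc 0 1 zero_le_one x, w))
  have hm : Measurable h := hg.1.comp ((measurable_laaksoMap t js).comp
      (continuous_projIcc.measurable.prodMk measurable_const))
  -- Since `r ≥ 1`, `g ≤ 1 + g ^ r`, so finiteness of the `r`-th power integral on the segment gives
  -- integrability.
  have hfin : ∫⁻ x in Icc 0 1, h x < ∞ := by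
    rw [← unitInterval.measurePreserving_coe.lintegral_comp hm]
    refine (lintegral_mono (g := fun x : unitInterval => 1 + g (laaksoMap t js (x, w)) ^ r)
      fun x => ?_).trans_lt ?_
    · simp only [h, projIcc_val]
      rcases le_total (g (laaksoMap t js (x, w))) 1 with h1 | h1
      · exact h1.trans le_self_add
      · refine le_trans ?_ le_add_self
        simpa using ENNReal.rpow_le_rpow_of_exponent_le h1 hr
    · rw [lintegral_add_left measurable_const, lintegral_const]
      exact ENNReal.add_lt_top.2 ⟨ENNReal.mul_lt_top ENNReal.one_lt_top (measure_lt_top _ _), hw⟩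
  have hae := ae_abs_deriv_le_of_forall_abs_sub_le_lintegral hm hfin
    fun a b ha hab hb => ofReal_abs_pullback_sub_le hg w ha hab hb
  have hfinW : ∀ᵐ x : ℝ, x ∉ wormholeLocUpTo js n ∪ {0, 1} :=
    measure_eq_zero_iff_ae_notMem.1
      (((finite_wormholeLocUpTo js n).union (toFinite _)).measure_zero volume)
  filter_upwards [unitInterval.measurePreserving_coe.quasiMeasurePreserving.ae
    (ae_restrict_of_ae (hae.and hfinW))] with x hx
  obtain ⟨hx1, hx2⟩ := hx
  simp only [mem_union, mem_insert_iff, mem_singleton_iff, not_or] at hx2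
  have h01 : (x : ℝ) ∈ Ioo (0 : ℝ) 1 :=
    ⟨lt_of_le_of_ne x.2.1 (Ne.symm hx2.2.1), lt_of_le_of_ne x.2.2 hx2.2.2⟩
  have := hx1 h01 _ ((hasDerivWithinAt_pullback hf w ⟨x.2, hx2.1⟩).hasDerivAt
    (Icc_mem_nhds h01.1 h01.2))
  simp only [h, projIcc_val] at this
  exact this

/-! ### The arc length parameterization of a rectifiable curve -/

section ArcLength

variable {X : Type*} [PseudoEMetricSpace X] {γ : ℝ → X}

theorem continuousOn_variationOnFromTo {s : Set ℝ} (hc : ContinuousOn γ s)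
    (hb : BoundedVariationOn γ s) {a : ℝ} (ha : a ∈ s) :
    ContinuousOn (variationOnFromTo γ s a) s := by
  intro x hx
  have hl := hb.tendsto_eVariationOn_Icc_zero_left ((hc x hx).mono (inter_subset_left (t := Iic x)))
  have hr := hb.tendsto_eVariationOn_Icc_zero_right x
    ((hc x hx).mono (inter_subset_left (t := Ici x)))
  -- The sum of the variations on the left and on the right of `x` dominates the increment,
  -- whichever side `y` lies on.
  have hsum := ((ENNReal.tendsto_toReal ENNReal.zero_ne_top).comp hl).add
    ((ENNReal.tendsto_toReal ENNReal.zero_ne_top).comp hr)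
  rw [ENNReal.toReal_zero, add_zero] at hsum
  rw [ContinuousWithinAt, tendsto_iff_dist_tendsto_zero]
  refine squeeze_zero' (Eventually.of_forall fun _ => dist_nonneg) ?_ hsum
  filter_upwards [self_mem_nhdsWithin] with y hy
  have hadd := variationOnFromTo.add hb.locallyBoundedVariationOn ha hx hy
  rw [Real.dist_eq, ← hadd, add_sub_cancel_left]
  rcases le_total x y with h | h
  · rw [variationOnFromTo.eq_of_le _ _ h, abs_of_nonneg ENNReal.toReal_nonneg]
    exact le_add_of_nonneg_left ENNReal.toReal_nonneg
  · rw [variationOnFromTo.eq_of_ge _ _ h, abs_neg, abs_of_nonneg ENNReal.toReal_nonneg]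
    exact le_add_of_nonneg_right ENNReal.toReal_nonneg

theorem variationOnFromTo_zero_one :
    variationOnFromTo γ (Icc 0 1) 0 1 = (eVariationOn γ (Icc 0 1)).toReal := by
  rw [variationOnFromTo.eq_of_le _ _ zero_le_one, inter_self]

theorem IsRectifiable.lipschitzOnWith_naturalParameterization (hγ : IsRectifiable γ) :
    LipschitzOnWith 1 (naturalParameterization γ (Icc 0 1) 0)
      (Icc 0 (eVariationOn γ (Icc 0 1)).toReal) := by
  have hb : BoundedVariationOn γ (Icc 0 1) := hγ.2
  have h0 : (0 : ℝ) ∈ Icc (0 : ℝ) 1 := left_mem_Icc.2 zero_le_one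
  -- Continuity makes the arc length function attain every value in `[0, length γ]`; the unit speed
  -- property holds only on its range.
  have hsub := intermediate_value_Icc (zero_le_one' ℝ) (continuousOn_variationOnFromTo hγ.1 hb h0)
  rw [variationOnFromTo.self, variationOnFromTo_zero_one] at hsub
  have hunit := has_unit_speed_naturalParameterization γ hb.locallyBoundedVariationOn h0
  have key : ∀ x ∈ Icc 0 (eVariationOn γ (Icc 0 1)).toReal,
      ∀ y ∈ Icc 0 (eVariationOn γ (Icc 0 1)).toReal, x ≤ y →
      edist (naturalParameterization γ (Icc 0 1) 0 x) (naturalParameterization γ (Icc 0 1) 0 y) ≤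
        edist x y := by
    intro x hx y hy hxy
    refine (eVariationOn.edist_le (naturalParameterization γ (Icc 0 1) 0)
      (s := variationOnFromTo γ (Icc 0 1) 0 '' Icc 0 1 ∩ Icc x y) ⟨hsub hx, left_mem_Icc.2 hxy⟩
      ⟨hsub hy, right_mem_Icc.2 hxy⟩).trans (le_of_eq ?_)
    rw [hunit (hsub hx) (hsub hy), NNReal.coe_one, one_mul, edist_comm, edist_dist, Real.dist_eq,
      abs_of_nonneg (sub_nonneg.2 hxy)]
  intro x hx y hy
  rw [ENNReal.coe_one, one_mul]
  rcases le_total x y with h | h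
  · exact key x hx y hy h
  · rw [edist_comm, edist_comm x]
    exact key y hy x hx h

/-- The parameter chosen for arc length `0` need not be `0`, and points at distance zero may differ
in a pseudometric space, so equality is replaced by distance zero. -/
theorem IsRectifiable.edist_naturalParameterization_zero (hγ : IsRectifiable γ) :
    edist (naturalParameterization γ (Icc 0 1) 0 0) (γ 0) = 0 := by
  have h := edist_naturalParameterization_eq_zero
    (BoundedVariationOn.locallyBoundedVariationOn hγ.2) (left_mem_Icc.2 (zero_le_one' ℝ))
    (left_mem_Icc.2 (zero_le_one' ℝ))
  rwa [variationOnFromTo.self] at h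

theorem IsRectifiable.edist_naturalParameterization_length (hγ : IsRectifiable γ) :
    edist (naturalParameterization γ (Icc 0 1) 0 (eVariationOn γ (Icc 0 1)).toReal) (γ 1) = 0 := by
  have h := edist_naturalParameterization_eq_zero
    (BoundedVariationOn.locallyBoundedVariationOn hγ.2) (left_mem_Icc.2 (zero_le_one' ℝ))
    (right_mem_Icc.2 (zero_le_one' ℝ))
  rwa [variationOnFromTo_zero_one] at h

end ArcLength

/-! ### Functions with a bounded pointwise Lipschitz constant -/

section PointwiseLipschitz

variable {v k : ℝ → ℝ} {M l : ℝ}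

theorem sub_le_mul_of_pointwise_lipschitz {a b : ℝ} (hc : ContinuousOn v (Icc a b)) (hab : a ≤ b)
    (hv : ∀ x ∈ Ico a b, ∀ ε > 0, ∀ᶠ y in 𝓝[>] x, v y - v x ≤ (M + ε) * (y - x)) :
    v b - v a ≤ M * (b - a) := by
  have h := image_le_of_liminf_slope_right_le_deriv_boundary hc (B := fun x => v a + M * (x - a))
    (B' := fun _ => M) (by simp) (by fun_prop) (fun x _ => by
      simpa using ((((hasDerivAt_id x).sub_const a).const_mul M).const_add (v a)).hasDerivWithinAt)
    (fun x hx r hr => by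
      refine Eventually.frequently ?_
      -- Half of the gap `r - M` as the error keeps the slope strictly below `r`.
      filter_upwards [hv x hx ((r - M) / 2) (by linarith), self_mem_nhdsWithin] with y hy hxy
      have hpos : 0 < y - x := sub_pos.2 hxy
      rw [slope_def_field, div_lt_iff₀ hpos]
      exact hy.trans_lt (mul_lt_mul_of_pos_right (by linarith) hpos))
    (right_mem_Icc.2 hab)
  linarith

/-- The uniform bound `M` makes `v` Lipschitz, hence absolutely continuous, so its increment is the
integral of `deriv v`. The pointwise bound gives `|deriv v| ≤ k`, trivially where `v` is not
differentiable. -/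
theorem ofReal_abs_sub_le_lintegral_of_pointwise_lipschitz (hl : 0 ≤ l) (hk0 : ∀ x, 0 ≤ k x)
    (hkM : ∀ x, k x ≤ M) (hv : ∀ x ∈ Icc 0 l, ∀ ε > 0,
      ∀ᶠ y in 𝓝[Icc 0 l] x, |v y - v x| ≤ (k x + ε) * |y - x|) :
    ENNReal.ofReal |v 0 - v l| ≤ ∫⁻ x in Icc 0 l, ENNReal.ofReal (k x) := by
  have hM : 0 ≤ M := (hk0 0).trans (hkM 0)
  have hcont : ContinuousOn v (Icc 0 l) := by
    intro x hx
    rw [ContinuousWithinAt, tendsto_iff_dist_tendsto_zero]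
    have h0 : Tendsto (fun y => (k x + 1) * |y - x|) (𝓝[Icc 0 l] x) (𝓝 0) := by
      have : Continuous fun y => (k x + 1) * |y - x| := by fun_prop
      simpa using (this.tendsto x).mono_left nhdsWithin_le_nhds
    exact squeeze_zero' (Eventually.of_forall fun _ => dist_nonneg) (hv x hx 1 one_pos) h0
  have hlip : ∀ a ∈ Icc 0 l, ∀ b ∈ Icc 0 l, a ≤ b → |v b - v a| ≤ M * (b - a) := by
    intro a ha b hb hab
    have hsub : Icc a b ⊆ Icc 0 l := Icc_subset_Icc ha.1 hb.2
    have hev : ∀ x ∈ Ico a b, ∀ ε > 0, ∀ᶠ y in 𝓝[>] x, |v y - v x| ≤ (M + ε) * (y - x) := by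
      intro x hx ε hε
      have hle : 𝓝[>] x ≤ 𝓝[Icc 0 l] x := by
        rw [← nhdsWithin_Ioo_eq_nhdsGT hx.2]
        exact nhdsWithin_mono x fun y hy => hsub ⟨hx.1.trans hy.1.le, hy.2.le⟩
      filter_upwards [hle (hv x (hsub (Ico_subset_Icc_self hx)) ε hε), self_mem_nhdsWithin]
        with y hy hxy
      have hpos : 0 < y - x := sub_pos.2 hxy
      rw [abs_of_pos hpos] at hy
      exact hy.trans (mul_le_mul_of_nonneg_right (by linarith [hkM x]) hpos.le)
    have h1 := sub_le_mul_of_pointwise_lipschitz (hcont.mono hsub) hab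
      fun x hx ε hε => (hev x hx ε hε).mono fun y hy => (le_abs_self _).trans hy
    have h2 := sub_le_mul_of_pointwise_lipschitz (v := fun x => -v x) (M := M) (hcont.mono hsub).neg hab
      fun x hx ε hε => (hev x hx ε hε).mono fun y hy => by
        linarith [neg_abs_le (v y - v x)]
    exact abs_le.2 ⟨by linarith, h1⟩
  have hL : LipschitzOnWith M.toNNReal v (uIcc 0 l) := by
    rw [uIcc_of_le hl]
    refine LipschitzOnWith.of_dist_le_mul fun x hx y hy => ?_
    rw [Real.coe_toNNReal _ hM, Real.dist_eq, Real.dist_eq]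
    rcases le_total x y with h | h
    · rw [abs_sub_comm, abs_sub_comm x, abs_of_nonneg (sub_nonneg.2 h)]
      exact hlip x hx y hy h
    · rw [abs_of_nonneg (sub_nonneg.2 h)]
      exact hlip y hy x hx h
  have hderiv : ∀ x ∈ Ioo 0 l, |deriv v x| ≤ k x := by
    intro x hx
    by_cases hd : DifferentiableAt ℝ v x
    swap
    · rw [deriv_zero_of_not_differentiableAt hd, abs_zero]
      exact hk0 x
    refine le_of_forall_pos_le_add fun ε hε => ?_
    refine le_of_tendsto (hasDerivAt_iff_tendsto_slope.1 hd.hasDerivAt).abs ?_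
    have hx' := hv x (Ioo_subset_Icc_self hx) ε hε
    rw [nhdsWithin_eq_nhds.2 (Icc_mem_nhds hx.1 hx.2)] at hx'
    filter_upwards [mem_nhdsWithin_of_mem_nhds hx', self_mem_nhdsWithin] with y hy hxy
    rw [slope_def_field, abs_div, div_le_iff₀ (abs_pos.2 (sub_ne_zero.2 hxy))]
    exact hy
  have hftc := hL.absolutelyContinuousOnInterval.integral_deriv_eq_sub
  rw [intervalIntegral.integral_of_le hl, integral_Ioc_eq_integral_Ioo] at hftc
  rw [abs_sub_comm, ← hftc, ← Real.enorm_eq_ofReal_abs]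
  refine (enorm_integral_le_lintegral_enorm _).trans ?_
  refine (setLIntegral_mono' measurableSet_Ioo fun x hx => ?_).trans
    (lintegral_mono_set Ioo_subset_Icc_self)
  rw [Real.enorm_eq_ofReal_abs]
  exact ENNReal.ofReal_le_ofReal (hderiv x hx)

end PointwiseLipschitz

/-- A contraction of the real line which is close to the identity and locally constant near the
points of a given finite set. -/
theorem exists_contraction_eventually_const {E : Set ℝ} (hE : E.Finite) :
    ∀ ε > 0, ∃ φ : ℝ → ℝ, (∀ x y, |φ x - φ y| ≤ |x - y|) ∧ (∀ x, |φ x - x| ≤ ε) ∧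
      ∀ e ∈ E, ∀ᶠ x in 𝓝 e, φ x = φ e := by
  induction E, hE using Set.Finite.induction_on with
  | empty => exact fun ε hε => ⟨id, fun _ _ => le_rfl, fun x => by simp [hε.le], by simp⟩
  | @insert e E _ _ ih =>
    intro ε hε
    obtain ⟨φ, h1, h2, h3⟩ := ih (ε / 2) (half_pos hε)
    set δ := ε / 2
    have hδ : 0 < δ := half_pos hε
    -- Every point moves towards `φ e` by at most `δ`, which collapses the interval of radius `δ` to
    -- its centre. The centre is `φ e`, not `e`, because `σ` is applied after `φ`.
    let σ : ℝ → ℝ := fun z => z - max (-δ) (min δ (z - φ e))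
    have hσ1 : ∀ x y, |σ x - σ y| ≤ |x - y| := by
      intro x y
      simp only [σ]
      rw [abs_le]
      constructor <;> rcases abs_cases (x - y) with ⟨h, h'⟩ | ⟨h, h'⟩ <;> rw [h] <;>
        rcases max_cases (-δ) (min δ (x - φ e)) with ⟨ha, ha'⟩ | ⟨ha, ha'⟩ <;> rw [ha] <;>
        rcases max_cases (-δ) (min δ (y - φ e)) with ⟨hb, hb'⟩ | ⟨hb, hb'⟩ <;> rw [hb] <;>
        rcases min_cases δ (x - φ e) with ⟨hc, hc'⟩ | ⟨hc, hc'⟩ <;>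
        rcases min_cases δ (y - φ e) with ⟨hd, hd'⟩ | ⟨hd, hd'⟩ <;> linarith
    have hσ2 : ∀ x, |σ x - x| ≤ δ := by
      intro x
      simp only [σ, sub_sub_cancel_left, abs_neg]
      exact abs_le.2 ⟨le_max_left _ _, max_le (by linarith) (min_le_left _ _)⟩
    have hσ3 : ∀ z, |z - φ e| < δ → σ z = φ e := by
      intro z hz
      obtain ⟨hz1, hz2⟩ := abs_lt.1 hz
      simp only [σ]
      rw [min_eq_right hz2.le, max_eq_right hz1.le, sub_sub_cancel]
    refine ⟨σ ∘ φ, fun x y => (hσ1 _ _).trans (h1 x y), fun x => ?_, ?_⟩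
    · have := abs_add_le (σ (φ x) - φ x) (φ x - x)
      rw [sub_add_sub_cancel] at this
      have ha := hσ2 (φ x)
      have hb := h2 x
      simp only [Function.comp_apply]
      have hδε : δ + δ = ε := add_halves ε
      linarith
    · rintro e' (rfl | he')
      · filter_upwards [Metric.ball_mem_nhds e' hδ] with x hx
        rw [Metric.mem_ball, Real.dist_eq] at hx
        simp only [Function.comp_apply]
        rw [hσ3 _ ((h1 _ _).trans_lt hx), hσ3 _ (by simpa using hδ)]
      · exact (h3 e' he').mono fun x hx => congrArg σ hx

/-! ### The absolute value of the horizontal derivative is an upper gradient -/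

/-- Along a curve which is parameterized by arc length, the pointwise Lipschitz constant of `f` is
at most the absolute value of its horizontal derivative, away from the wormholes of level at most
`n`. -/
theorem eventually_abs_sub_le_of_lipschitzOnWith {t : ℝ} (h0 : 0 < t) (h2 : t < 1 / 2)
    {js : ℕ → ℕ} {n : ℕ} {f : C(Laakso t js, ℝ)} (hf : f ∈ classG t js n) {c : ℝ → Laakso t js}
    {T : Set ℝ} (hc : LipschitzOnWith 1 c T) {s : ℝ} (hs : s ∈ T) {x : unitInterval}
    {w : cantorK t} (hxw : c s = laaksoMap t js (x, w)) (hx : (x : ℝ) ∉ wormholeLocUpTo js n)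
    {ε : ℝ} (hε : 0 < ε) :
    ∀ᶠ s' in 𝓝[T] s, |f (c s') - f (c s)| ≤ (|horizontalDeriv f n w x| + ε) * |s' - s| := by
  have hheight : ∀ s' ∈ T, |height t js (c s') - x| ≤ |s' - s| := by
    intro s' hs'
    have h := hc hs' hs
    rw [ENNReal.coe_one, one_mul, edist_dist, Real.dist_eq] at h
    have := abs_height_sub_le (abs_nonneg _) h
    rwa [hxw] at this
  have hIcc : ∀ q : Laakso t js, height t js q ∈ Icc (0 : ℝ) 1 := by
    intro q
    obtain ⟨z, rfl⟩ := Quot.exists_rep q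
    exact z.1.2
  have htend : Tendsto (fun s' => height t js (c s')) (𝓝[T] s) (𝓝[Icc 0 1] (x : ℝ)) := by
    refine tendsto_nhdsWithin_iff.2 ⟨?_, Eventually.of_forall fun s' => hIcc _⟩
    rw [tendsto_iff_dist_tendsto_zero]
    have hz : Tendsto (fun y => |y - s|) (𝓝[T] s) (𝓝 0) := by
      have : Continuous fun y => |y - s| := by fun_prop
      simpa using (this.tendsto s).mono_left nhdsWithin_le_nhds
    refine squeeze_zero' (Eventually.of_forall fun _ => dist_nonneg) ?_ hz
    filter_upwards [self_mem_nhdsWithin] with s' hs' using hheight s' hs'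
  have hd := htend.eventually
    ((hasDerivWithinAt_iff_isLittleO.1 (hasDerivWithinAt_pullback hf w ⟨x.2, hx⟩)).def hε)
  -- Near `s` the curve stays in the cell of `w`, so `f ∘ c` is `pullback f w` of the height, which
  -- is a 1-Lipschitz function of `s'`.
  have hcell := (hxw ▸ hc.continuousOn s hs : Tendsto c (𝓝[T] s) (𝓝 (laaksoMap t js (x, w))))
    |>.eventually (eventually_mem_cell h0 h2 hx)
  filter_upwards [hd, hcell, self_mem_nhdsWithin] with s' hd ⟨x', w', hxw', hw'⟩ hs'
  have hval : ∀ (y : unitInterval) (w : cantorK t), f (laaksoMap t js (y, w)) = pullback f w y :=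
    fun y w => by rw [pullback, projIcc_val]
  have hx' : |(x' : ℝ) - x| ≤ |s' - s| := by
    have := hheight s' hs'
    rwa [hxw'] at this
  rw [hxw'] at hd
  change ‖pullback f w x' - pullback f w x - ((x' : ℝ) - x) • horizontalDeriv f n w x‖ ≤
    ε * ‖(x' : ℝ) - x‖ at hd
  rw [hxw, hxw', hval, hval, pullback_eq_of_prefix_eq h0 h2 hf hw']
  rw [Real.norm_eq_abs, Real.norm_eq_abs, smul_eq_mul] at hd
  calc |pullback f w x' - pullback f w x|
      ≤ |pullback f w x' - pullback f w x - ((x' : ℝ) - x) * horizontalDeriv f n w x| +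
        |((x' : ℝ) - x) * horizontalDeriv f n w x| := by
          simpa using abs_add_le (pullback f w x' - pullback f w x -
            ((x' : ℝ) - x) * horizontalDeriv f n w x) (((x' : ℝ) - x) * horizontalDeriv f n w x)
    _ ≤ ε * |(x' : ℝ) - x| + |(x' : ℝ) - x| * |horizontalDeriv f n w x| := by
          rw [abs_mul]
          exact add_le_add_left hd _
    _ = (|horizontalDeriv f n w x| + ε) * |(x' : ℝ) - x| := by ring
    _ ≤ _ := mul_le_mul_of_nonneg_left hx' (by positivity)

theorem isGeneralizedUpperGradient_horizontalSlope {t : ℝ} (h0 : 0 < t) (h2 : t < 1 / 2)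
    {js : ℕ → ℕ} {n : ℕ} {f : C(Laakso t js, ℝ)} (hf : f ∈ classG t js n) :
    IsGeneralizedUpperGradient f (horizontalSlope h0 h2 hf) := by
  refine ⟨measurable_horizontalSlope h0 h2 hf, fun γ hγ => ?_⟩
  set l := (eVariationOn γ (Icc 0 1)).toReal with hl
  set c := naturalParameterization γ (Icc 0 1) 0 with hcdef
  have hc : LipschitzOnWith 1 c (Icc 0 l) := hγ.lipschitzOnWith_naturalParameterization
  have hfeq : ∀ p q : Laakso t js, edist p q = 0 → f p = f q := fun p q h =>
    ((EMetric.inseparable_iff.2 h).map f.continuous).eq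
  rw [← hfeq _ _ hγ.edist_naturalParameterization_zero,
    ← hfeq _ _ hγ.edist_naturalParameterization_length, ← hl, ← hcdef]
  obtain ⟨C, -, hC⟩ := exists_bound_horizontalDeriv h0 h2 hf
  let k : ℝ → ℝ := fun s => (horizontalSlope h0 h2 hf (c s)).toReal
  have hkeq : ∀ {s x w}, c s = laaksoMap t js (x, w) → k s = |horizontalDeriv f n w x| := by
    intro s x w h
    simp only [k, h, horizontalSlope_laaksoMap, ENNReal.toReal_ofReal (abs_nonneg _)]
  have hkC : ∀ s, k s ≤ C := by
    intro s
    obtain ⟨z, hz⟩ := Quot.exists_rep (c s)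
    rw [hkeq (x := z.1) (w := z.2) hz.symm]
    exact hC _ _
  -- All values of `f` at the exceptional heights: finitely many heights times finitely many words.
  let E : Set ℝ := ⋃ b : Fin n → Bool, pullback f (cantorBase t b) '' wormholeLocUpTo js n
  have hE : E.Finite := finite_iUnion fun b => (finite_wormholeLocUpTo js n).image _
  -- The loss `2 * ε` comes from moving both end values by at most `ε`.
  have hmain : ∀ ε > 0, ENNReal.ofReal (|f (c 0) - f (c l)| - 2 * ε) ≤
      ∫⁻ s in Icc 0 l, ENNReal.ofReal (k s) := by
    intro ε hε
    obtain ⟨φ, h1, h3, hφ⟩ := exists_contraction_eventually_const hE ε hε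
    refine le_trans (ENNReal.ofReal_le_ofReal ?_)
      (ofReal_abs_sub_le_lintegral_of_pointwise_lipschitz (v := fun s => φ (f (c s))) (M := C)
        ENNReal.toReal_nonneg (fun s => ENNReal.toReal_nonneg) hkC ?_)
    · have ha := abs_le.1 (h3 (f (c 0)))
      have hb := abs_le.1 (h3 (f (c l)))
      have hd := abs_le.1 (le_refl |φ (f (c 0)) - φ (f (c l))|)
      rw [sub_le_iff_le_add, abs_le]
      constructor <;> linarith [ha.1, ha.2, hb.1, hb.2, hd.1, hd.2]
    · intro s hs η hη
      obtain ⟨⟨x, w⟩, hz⟩ := Quot.exists_rep (c s)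
      have hxw : c s = laaksoMap t js (x, w) := hz.symm
      rw [hkeq hxw]
      -- At an exceptional height `φ ∘ f ∘ c` is constant near `s`, which matches the slope `0`
      -- there; elsewhere `φ` does not increase differences.
      by_cases hx : (x : ℝ) ∈ wormholeLocUpTo js n
      · have hmem : f (c s) ∈ E := by
          refine mem_iUnion.2 ⟨cantorPrefix t n w, x, hx, ?_⟩
          rw [pullback_eq_of_prefix_eq h0 h2 hf (cantorPrefix_base h0 h2 _), hxw, pullback,
            projIcc_val]
        filter_upwards [(f.continuous.comp_continuousOn hc.continuousOn s hs).eventually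
          (hφ _ hmem)] with s' hs'
        simp only [Function.comp_apply] at hs'
        rw [hs', sub_self, abs_zero]
        positivity
      · exact (eventually_abs_sub_le_of_lipschitzOnWith h0 h2 hf hc hs hxw hx hη).mono
          fun s' h => (h1 _ _).trans h
  have hlim : Tendsto (fun ε : ℝ => ENNReal.ofReal (|f (c 0) - f (c l)| - 2 * ε)) (𝓝[>] 0)
      (𝓝 (ENNReal.ofReal |f (c 0) - f (c l)|)) := by
    have : Continuous fun ε : ℝ => ENNReal.ofReal (|f (c 0) - f (c l)| - 2 * ε) :=
      ENNReal.continuous_ofReal.comp (by fun_prop)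
    simpa using (this.tendsto 0).mono_left nhdsWithin_le_nhds
  refine (le_of_tendsto hlim (eventually_mem_nhdsWithin.mono hmain)).trans ?_
  exact lintegral_mono fun s => ENNReal.ofReal_toReal_le

/-- The absolute value of the horizontal derivative of a function of class `𝒢_n` is a minimal
generalized upper gradient. -/
theorem isMinimalGeneralizedUpperGradient_horizontalSlope {t : ℝ} (h0 : 0 < t) (h2 : t < 1 / 2)
    {js : ℕ → ℕ} {n : ℕ} {f : C(Laakso t js, ℝ)} (hf : f ∈ classG t js n) {r : ℝ} (hr : 1 ≤ r) :
    IsMinimalGeneralizedUpperGradient (laaksoMeasure t js) r f (horizontalSlope h0 h2 hf) :=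
  ⟨isGeneralizedUpperGradient_horizontalSlope h0 h2 hf,
    lintegral_horizontalSlope_lt_top h0 h2 hf (zero_le_one.trans hr),
    fun _ hg hgr => horizontalSlope_ae_le h0 h2 hf hr hg hgr⟩

end

theorem mainTheorem7 (Q t : ℝ) (j : ℕ) (js : ℕ → ℕ) (hL : IsLaaksoData Q t j js)
    (n : ℕ) (f : C(Laakso t js, ℝ)) (hf : f ∈ classG t js n) (r : ℝ) (hr : 1 < r) :
    (∃ p : Laakso t js → ℝ≥0∞,
      IsMinimalGeneralizedUpperGradient (laaksoMeasure t js) r f p) ∧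
    ∀ p : Laakso t js → ℝ≥0∞,
      IsMinimalGeneralizedUpperGradient (laaksoMeasure t js) r f p →
      ∀ᵐ q ∂(laaksoMeasure t js), ∀ (x : unitInterval) (w : cantorK t),
        laaksoMap t js (x, w) = q → (x : ℝ) ∉ wormholeLocUpTo js n →
          ∃ D : ℝ, HasDerivWithinAt (pullback f w) D (Icc 0 1) x ∧ p q = ENNReal.ofReal |D| := by
  have h0 := hL.ratio_mem.1
  have h2 := hL.ratio_lt_half
  have hmin := isMinimalGeneralizedUpperGradient_horizontalSlope h0 h2 hf hr.le
  refine ⟨⟨_, hmin⟩, fun p hp => ?_⟩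
  -- The exceptional null set depends on `q` alone: the slope is a function on `L`, so every
  -- representative `(x, w)` computes it.
  filter_upwards [hp.2.2 _ hmin.1 hmin.2.1, hmin.2.2 _ hp.1 hp.2.1] with q hq hq' x w hxw hx
  refine ⟨_, hasDerivWithinAt_pullback hf w ⟨x.2, hx⟩, ?_⟩
  rw [le_antisymm hq hq', ← hxw, horizontalSlope_laaksoMap]
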